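/- Let $n\ge 2$ be even, $J>0$, and for $h\in\mathbb R$ let $$H(h)=\sum_{l=1}^{n}\bigl(J\sigma^x_l\sigma^x_{l+1}+J\sigma^y_l\sigma^y_{l+1}+h\,\sigma^z_l\bigr),\qquad \sigma^\alpha_{n+1}\equiv\sigma^\alpha_1,$$ be the isotropic periodic XX chain of $n$ qubits in a uniform field $h$ (for $n=2$ the single bond is counted twice). Let $S_z=\sum_{l}\sigma^z_l$; a vector $\psi$ with $S_z\psi=s_z\psi$ is said to have spin projection $s_z$. For a unit vector $\psi$ let $C_n(\psi)=|\langle\psi|\mho|\psi\rangle|$ be its $n$-concurrence, where $\mho=\bigl[\prod_{j=1}^n(-i\sigma^y_j)\bigr]\tau$ and $\tau$ is complex conjugation in the computational basis. A ground state of $H(h)$ is a unit eigenvector for its smallest eigenvalue; the eigenspace of that eigenvalue is the ground space. Put $$h_{\mathrm{crit}}=2J\tan\frac{\pi}{2n}.$$ Then: 1. The ground energy of $H(0)$ is $E_0=-4J\csc(\pi/n)$. 2. If $|h|<h_{\mathrm{crit}}$, the ground space is one-dimensional, and the ground state has $s_z=0$ and $C_n=1$. 3. If $|h|=h_{\mathrm{crit}}$,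 the ground space is two-dimensional, spanned by a ground state with $s_z=0$ and a ground state with $|s_z|=2$; the latter has $C_n=0$. 4. If $|h|>h_{\mathrm{crit}}$, every ground state has $C_n=0$; there are ground states that are eigenvectors of $S_z$, and all of these have $|s_z|\ge 2$. 5. $h_{\mathrm{crit}}$ is the smallest field strength $|h|$ at which there are both a ground state with $s_z=0$ and a ground state with $|s_z|=2$. It is also the smallest field strength $|h|$ at which the ground space has dimension at least $2$. -/

import Mathlib

open scoped Matrix

noncomputable section

namespace XXChain

/-- Configurations of `n` qubits: labels of the computational basis of `(ℂ²)^{⊗ n}`. The label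
`0 : Fin 2` is the `+1` eigenvector of `σ^z` (spin up), the label `1` the `-1` eigenvector. -/
abbrev Config (n : ℕ) : Type := Fin n → Fin 2

/-- Vectors of the `n`-qubit Hilbert space `(ℂ²)^{⊗ n}`, by coordinates in the computational
basis; the inner product of `φ` and `ψ` is `star φ ⬝ᵥ ψ`. -/
abbrev QVec (n : ℕ) : Type := Config n → ℂ

/-- Operators on `n` qubits as matrices in the computational basis. -/
abbrev QOp (n : ℕ) : Type := Matrix (Config n) (Config n) ℂ

/-- The Pauli matrix `σ^x`. -/
def pauliX : Matrix (Fin 2) (Fin 2) ℂ := !![0, 1; 1, 0]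

/-- The Pauli matrix `σ^y`. -/
def pauliY : Matrix (Fin 2) (Fin 2) ℂ := !![0, -Complex.I; Complex.I, 0]

/-- The Pauli matrix `σ^z`. -/
def pauliZ : Matrix (Fin 2) (Fin 2) ℂ := !![1, 0; 0, -1]

/-- The tensor (Kronecker) product `A 0 ⊗ A 1 ⊗ ⋯ ⊗ A (n-1)` of one-qubit operators. -/
def tensorOp {n : ℕ} (A : Fin n → Matrix (Fin 2) (Fin 2) ℂ) : QOp n :=
  Matrix.of fun s t => ∏ l, A l (s l) (t l)

/-- The one-qubit operator `A` acting on site `l`, and the identity on all other sites. -/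
def siteOp {n : ℕ} (A : Matrix (Fin 2) (Fin 2) ℂ) (l : Fin n) : QOp n :=
  tensorOp fun k => if k = l then A else 1

/-- The collective spin projection `S_z = ∑_l σ^z_l`. -/
def totalSz (n : ℕ) : QOp n := ∑ l : Fin n, siteOp pauliZ l

/-- The isotropic periodic XX chain in a uniform field,
`H_XX(h) = ∑_l (J σ^x_l σ^x_{l+1} + J σ^y_l σ^y_{l+1} + h σ^z_l)`.
The addition `l + 1` in `Fin n` is modulo `n`, which is the cyclic boundary condition. -/
def hamXX (n : ℕ) [NeZero n] (J h : ℝ) : QOp n :=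
  ∑ l : Fin n,
    ((J : ℂ) • (siteOp pauliX l * siteOp pauliX (l + 1))
      + (J : ℂ) • (siteOp pauliY l * siteOp pauliY (l + 1))
      + (h : ℂ) • siteOp pauliZ l)

/-- The antiunitary time reversal `(⊗_j (-i σ^y_j)) τ`, with `τ` the complex conjugation of
coordinates in the computational basis. -/
def timeReversal {n : ℕ} (ψ : QVec n) : QVec n :=
  tensorOp (fun _ : Fin n => (-Complex.I) • pauliY) *ᵥ star ψ

/-- The `n`-concurrence `|⟨ψ| ℧ |ψ⟩|` of a pure state, `℧` being the time reversal. -/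
def nConcurrence {n : ℕ} (ψ : QVec n) : ℝ := ‖star ψ ⬝ᵥ timeReversal ψ‖

/-- The real eigenvalues of an operator (all its eigenvalues, if it is Hermitian). -/
def energyLevels {n : ℕ} (H : QOp n) : Set ℝ :=
  {E | Module.End.HasEigenvalue (Matrix.toLin' H) (E : ℂ)}

/-- The ground energy: the lowest energy level. -/
def groundEnergy {n : ℕ} (H : QOp n) : ℝ := sInf (energyLevels H)

/-- The ground space: the eigenspace of the ground energy. -/
def groundSpace {n : ℕ} (H : QOp n) : Submodule ℂ (QVec n) :=
  Module.End.eigenspace (Matrix.toLin' H) (groundEnergy H : ℂ)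

/-- A ground state: a normalized vector of the ground space. -/
def IsGroundState {n : ℕ} (H : QOp n) (ψ : QVec n) : Prop :=
  ψ ∈ groundSpace H ∧ star ψ ⬝ᵥ ψ = 1

/-- `ψ` has the definite spin projection `s`: it satisfies `S_z ψ = s ψ`. -/
def HasSz {n : ℕ} (ψ : QVec n) (s : ℝ) : Prop := totalSz n *ᵥ ψ = (s : ℂ) • ψ

/-- The critical field `h_crit = 2 J tan (π / (2 n))`. -/
def criticalField (n : ℕ) (J : ℝ) : ℝ := 2 * J * Real.tan (Real.pi / (2 * n))

end XXChain

end

/-!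
The proof avoids the Jordan-Wigner transformation. In the computational basis the Hamiltonian is
`2 J hop + h S_z`, where `hop` exchanges neighbouring opposite spins (`hamXX_mulVec`), so it
preserves the number `N` of up spins. The free-fermion ground state with `N` particles is a Slater
determinant of consecutive plane waves, hence a Vandermonde determinant; up to a phase its amplitude
at a configuration is the sublattice sign `stagger` times the product `weight` of the positive
numbers `|sin (π (i - j) / n)|` over all pairs of occupied sites. That this is an eigenvector of
`hop` with eigenvalue `-2 sin (π N / n) / sin (π / n)` is checked directly: it amounts to the
trigonometric identity `sum_prod_sin_sub_add_div`, which is Lagrange interpolation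
(`sub_one_mul_sum_prod_div_sub`).

Since `weight` is positive everywhere, writing a vector as `refVec * χ` turns `hop` plus its
claimed lowest eigenvalue into a Dirichlet form in `χ` (`sum_star_mul_hop`), which is
nonnegative and, as adjacent transpositions connect all configurations with the same `N`, vanishes
only if `χ` depends on `N` alone. So each sector has a unique ground state, of energy
`sectorEnergy n J h N`, and the ground space is spanned by those of the lowest sectors
(`mem_groundSpace_hamXX`).

It remains to compare the sector energies. Relative to `N = n / 2` they are
`2 h k + 4 J sin² (k a) / (sin a cos a)` with `k = N - n / 2` and `a = π / (2 n)`, and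
`sin² (k a) ≥ |k| sin² a`, with equality just for `|k| ≤ 1`; hence the transition at
`|h| = 2 J tan a` (`sectorEnergy_sub_half_bound`). The concurrence pairs the amplitudes of a
configuration and its spin flip, which exchanges `N` and `n - N`. It vanishes for states supported
on one side of `n / 2`. For `N = n / 2` the spin flip commutes with the zero-field Hamiltonian, so
the unique ground state is invariant up to a phase and has concurrence `1`.
-/

noncomputable section

namespace XXChain

/-! ### A trigonometric interpolation identity -/

/-- Lagrange interpolation of `∏ j, (q X - w j)` at the nodes `0` and `w i`: comparing leading
coefficients gives this `q`-analogue of `∑ i ∈ A, 1 = #A`. -/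
theorem sub_one_mul_sum_prod_div_sub {ι F : Type*} [DecidableEq ι] [Field F] (A : Finset ι)
    (w : ι → F) (q : F) (hw : Set.InjOn w A) (hw0 : ∀ i ∈ A, w i ≠ 0) :
    (q - 1) * ∑ i ∈ A, ∏ j ∈ A.erase i, (q * w i - w j) / (w i - w j) = q ^ A.card - 1 := by
  classical
  -- The index `none` stands for the extra node `0`.
  let v : Option ι → F := fun o => o.elim 0 w
  have hv : Set.InjOn v (Finset.insertNone A) := by
    rintro (_ | i) hi (_ | j) hj h
    · rfl
    · exact absurd h.symm (hw0 j (by simpa using hj))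
    · exact absurd h (hw0 i (by simpa using hi))
    · exact congrArg some (hw (by simpa using hi) (by simpa using hj) h)
  let P : Polynomial F := ∏ j ∈ A, (Polynomial.C q * Polynomial.X - Polynomial.C (w j))
  have hdeg (j : ι) :
      (Polynomial.C q * Polynomial.X - Polynomial.C (w j)).natDegree ≤ 1 := by
    rw [sub_eq_add_neg, ← Polynomial.C_neg]
    exact Polynomial.natDegree_linear_le
  have hcoeff : P.coeff A.card = q ^ A.card := by
    have := Polynomial.coeff_prod_of_natDegree_le (s := A)
      (fun j => Polynomial.C q * Polynomial.X - Polynomial.C (w j)) 1 (fun j _ => hdeg j)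
    rw [mul_one] at this
    rw [this]
    simp
  have hP : P.degree < (Finset.insertNone A).card := by
    refine lt_of_le_of_lt Polynomial.degree_le_natDegree ?_
    have : P.natDegree ≤ A.card := by
      refine (Polynomial.natDegree_prod_le _ _).trans ?_
      simpa using Finset.sum_le_sum (fun j (_ : j ∈ A) => hdeg j)
    rw [Finset.card_insertNone]
    exact_mod_cast Nat.lt_succ_of_le this
  have key := Lagrange.coeff_eq_sum hv hP
  have hnone : (Finset.insertNone A).erase none = A.map Function.Embedding.some := by
    ext (_ | i) <;> simp
  have hsome (i : ι) : (Finset.insertNone A).erase (some i) = Finset.insertNone (A.erase i) := by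
    ext (_ | j) <;> simp
  have hzero : P.eval 0 = ∏ j ∈ A, (0 - w j) := by
    simp [P, Polynomial.eval_prod]
  rw [Finset.card_insertNone, Nat.add_sub_cancel, hcoeff, Finset.sum_insertNone, hnone,
    Finset.prod_map] at key
  have h0 : P.eval (v none) / ∏ j ∈ A, (v none - v (Function.Embedding.some j)) = 1 := by
    change P.eval 0 / ∏ j ∈ A, (0 - w j) = 1
    rw [hzero, div_self]
    exact Finset.prod_ne_zero_iff.mpr fun j hj => by simpa using hw0 j hj
  rw [h0] at key
  rw [key, add_sub_cancel_left, Finset.mul_sum]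
  refine Finset.sum_congr rfl fun i hi => ?_
  rw [hsome, Finset.prod_insertNone]
  change _ = P.eval (w i) / ((w i - 0) * ∏ j ∈ A.erase i, (w i - w j))
  have hPi : P.eval (w i) = (q - 1) * w i * ∏ j ∈ A.erase i, (q * w i - w j) := by
    simp only [P, Polynomial.eval_prod]
    rw [← Finset.mul_prod_erase _ _ hi]
    simp
    left; ring
  rw [hPi, sub_zero, Finset.prod_div_distrib]
  have hwi := hw0 i hi
  field_simp

theorem csin_sub_add_div_csin_sub (x y a : ℂ) (h : Complex.sin (x - y) ≠ 0) :
    Complex.sin (x - y + a) / Complex.sin (x - y)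
      = Complex.exp (-(a * Complex.I))
        * ((Complex.exp (2 * a * Complex.I) * Complex.exp (2 * x * Complex.I)
            - Complex.exp (2 * y * Complex.I))
          / (Complex.exp (2 * x * Complex.I) - Complex.exp (2 * y * Complex.I))) := by
  have hx := Complex.exp_ne_zero (x * Complex.I)
  have hy := Complex.exp_ne_zero (y * Complex.I)
  have ha := Complex.exp_ne_zero (a * Complex.I)
  have e2 (z : ℂ) : Complex.exp (2 * z * Complex.I) = Complex.exp (z * Complex.I) ^ 2 := by
    rw [← Complex.exp_nat_mul]; push_cast; ring_nf
  have e1 : Complex.sin (x - y)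
      = (Complex.exp (2 * x * Complex.I) - Complex.exp (2 * y * Complex.I))
      * (-Complex.I / (2 * Complex.exp (x * Complex.I) * Complex.exp (y * Complex.I))) := by
    rw [Complex.sin, e2, e2, show -(x - y) * Complex.I = y * Complex.I - x * Complex.I by ring,
      show (x - y) * Complex.I = x * Complex.I - y * Complex.I by ring, Complex.exp_sub,
      Complex.exp_sub]
    field_simp
    ring
  have e3 : Complex.sin (x - y + a) = (Complex.exp (2 * a * Complex.I)
        * Complex.exp (2 * x * Complex.I) - Complex.exp (2 * y * Complex.I))
      * (-Complex.I / (2 * Complex.exp (x * Complex.I) * Complex.exp (y * Complex.I)))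
      * Complex.exp (-(a * Complex.I)) := by
    rw [Complex.sin, e2, e2, e2,
      show -(x - y + a) * Complex.I = y * Complex.I - (x * Complex.I + a * Complex.I) by ring,
      show (x - y + a) * Complex.I = x * Complex.I + a * Complex.I - y * Complex.I by ring,
      Complex.exp_sub, Complex.exp_sub, Complex.exp_neg, Complex.exp_add]
    field_simp
    ring
  have h' : Complex.exp (2 * x * Complex.I) - Complex.exp (2 * y * Complex.I) ≠ 0 := by
    intro h0; rw [e1, h0, zero_mul] at h; exact h rfl
  rw [e3, e1]
  field_simp

/-- The identity behind the eigenvalue equation of the ground state: for `θ j = π x j / n` and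
`a = ± π / n` the summand is the relative change of `∏ |sin (θ i - θ j)|` when the particle at
`x i` moves by one site. -/
theorem sum_prod_sin_sub_add_div {ι : Type*} [DecidableEq ι] (A : Finset ι) (θ : ι → ℝ) (a : ℝ)
    (hθ : ∀ i ∈ A, ∀ j ∈ A, i ≠ j → Real.sin (θ i - θ j) ≠ 0) (ha : Real.sin a ≠ 0) :
    ∑ i ∈ A, ∏ j ∈ A.erase i, Real.sin (θ i - θ j + a) / Real.sin (θ i - θ j)
      = Real.sin (A.card * a) / Real.sin a := by
  rcases A.eq_empty_or_nonempty with rfl | hA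
  · simp
  set q : ℂ := Complex.exp (2 * a * Complex.I)
  set r : ℂ := Complex.exp (a * Complex.I)
  let w : ι → ℂ := fun i => Complex.exp (2 * θ i * Complex.I)
  have hr : r ≠ 0 := Complex.exp_ne_zero _
  have hq : q = r ^ 2 := by
    simp only [q, r, ← Complex.exp_nat_mul]; push_cast; ring_nf
  have hsin (i j : ι) (hi : i ∈ A) (hj : j ∈ A) (hij : i ≠ j) :
      Complex.sin (θ i - θ j) ≠ 0 := by
    exact_mod_cast hθ i hi j hj hij
  have hw : Set.InjOn w A := by
    intro i hi j hj h
    by_contra hij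
    apply hsin i j hi hj hij
    rw [Complex.sin_eq_zero_iff]
    obtain ⟨k, hk⟩ := Complex.exp_eq_exp_iff_exists_int.mp h
    refine ⟨k, mul_right_cancel₀ (mul_ne_zero two_ne_zero Complex.I_ne_zero) ?_⟩
    linear_combination hk
  have hlag := sub_one_mul_sum_prod_div_sub A w q hw fun i _ => Complex.exp_ne_zero _
  have hsa : Complex.sin a ≠ 0 := by exact_mod_cast ha
  have hsinr (k : ℕ) : Complex.sin (k * a) = (r ^ (2 * k) - 1) * (-Complex.I / (2 * r ^ k)) := by
    have h1 : Complex.exp (k * a * Complex.I) = r ^ k := by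
      simp only [r, ← Complex.exp_nat_mul]; ring_nf
    have h2 : Complex.exp (-(k * a) * Complex.I) = (r ^ k)⁻¹ := by
      rw [← h1, ← Complex.exp_neg]; ring_nf
    rw [Complex.sin, h1, h2]
    field_simp
    ring
  have hs1 := hsinr 1
  have hq1 : q - 1 ≠ 0 := by
    intro h0
    apply hsa
    rw [Nat.cast_one, one_mul, mul_one, ← hq, h0, zero_mul] at hs1
    exact hs1
  have hsum : ∑ i ∈ A, ∏ j ∈ A.erase i,
      Complex.sin (θ i - θ j + a) / Complex.sin (θ i - θ j)
      = (r⁻¹) ^ (A.card - 1) * ∑ i ∈ A, ∏ j ∈ A.erase i, (q * w i - w j) / (w i - w j) := by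
    rw [Finset.mul_sum]
    refine Finset.sum_congr rfl fun i hi => ?_
    rw [← Finset.card_erase_of_mem hi, ← Finset.prod_const, ← Finset.prod_mul_distrib]
    refine Finset.prod_congr rfl fun j hj => ?_
    rw [csin_sub_add_div_csin_sub _ _ _
      (hsin i j hi (Finset.mem_of_mem_erase hj) (Finset.ne_of_mem_erase hj).symm),
      Complex.exp_neg]
  have hfin : ∑ i ∈ A, ∏ j ∈ A.erase i,
      Complex.sin (θ i - θ j + a) / Complex.sin (θ i - θ j)
      = Complex.sin (A.card * a) / Complex.sin a := by
    rw [hsum, eq_div_iff hsa]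
    apply mul_left_cancel₀ hq1
    rw [show ∀ S x y : ℂ, (q - 1) * (x * S * y) = x * y * ((q - 1) * S) by intros; ring, hlag,
      hsinr, show Complex.sin a = Complex.sin ((1 : ℕ) * a) by simp, hsinr]
    obtain ⟨m, hm⟩ : ∃ m, A.card = m + 1 := ⟨A.card - 1, (Nat.sub_add_cancel hA.card_pos).symm⟩
    rw [hm, hq, Nat.add_sub_cancel, ← pow_mul, inv_pow]
    field_simp
    ring
  have := congrArg Complex.re hfin
  rw [← Complex.ofReal_re (∑ i ∈ A, _), ← Complex.ofReal_re (_ / _)]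
  push_cast
  exact this

/-! ### The Hamiltonian in the computational basis -/

/-- The occupied sites of a configuration: those carrying an up spin. -/
def upSet {n : ℕ} (s : Config n) : Finset (Fin n) := Finset.univ.filter fun l => s l = 0

/-- The number of up spins. -/
def upCount {n : ℕ} (s : Config n) : ℕ := (upSet s).card

@[simp] theorem mem_upSet {n : ℕ} {s : Config n} {l : Fin n} : l ∈ upSet s ↔ s l = 0 := by
  simp [upSet]

theorem upCount_le {n : ℕ} (s : Config n) : upCount s ≤ n := by
  simpa [upCount] using Finset.card_le_univ (upSet s)

/-- Exchange of the spins at `l` and at the next site of the ring. -/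
def bondSwap {n : ℕ} [NeZero n] (l : Fin n) (s : Config n) : Config n :=
  s ∘ Equiv.swap l (l + 1)

@[simp] theorem bondSwap_bondSwap {n : ℕ} [NeZero n] (l : Fin n) (s : Config n) :
    bondSwap l (bondSwap l s) = s := by
  ext k; simp [bondSwap]

theorem upCount_comp_perm {n : ℕ} (s : Config n) (σ : Equiv.Perm (Fin n)) :
    upCount (s ∘ σ) = upCount s := by
  refine Finset.card_bij (fun l _ => σ l) (by simp) (fun a _ b _ h => σ.injective h) fun b hb => ?_
  exact ⟨σ.symm b, by simpa using hb, by simp⟩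

@[simp] theorem upCount_bondSwap {n : ℕ} [NeZero n] (l : Fin n) (s : Config n) :
    upCount (bondSwap l s) = upCount s := upCount_comp_perm _ _

/-- The hopping operator of the ring: `H(h) = 2 J hop + h S_z`. On two sites the bond is counted
twice. -/
def hop {n : ℕ} [NeZero n] (ψ : QVec n) : QVec n := fun s =>
  ∑ l : Fin n, if s l ≠ s (l + 1) then ψ (bondSwap l s) else 0

theorem siteOp_mulVec {n : ℕ} (A : Matrix (Fin 2) (Fin 2) ℂ) (l : Fin n) (ψ : QVec n)
    (s : Config n) :
    (siteOp A l *ᵥ ψ) s = ∑ b : Fin 2, A (s l) b * ψ (Function.update s l b) := by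
  have hinj : Function.Injective fun b : Fin 2 => Function.update s l b :=
    Function.update_injective s l
  rw [Matrix.mulVec, dotProduct, ← Finset.sum_subset
    (Finset.subset_univ (Finset.univ.map ⟨fun b : Fin 2 => Function.update s l b, hinj⟩)),
    Finset.sum_map]
  · refine Finset.sum_congr rfl fun b _ => ?_
    simp only [siteOp, tensorOp, Matrix.of_apply, Function.Embedding.coeFn_mk]
    rw [Finset.prod_eq_single l]
    · simp
    · intro k _ hk; simp [hk, Matrix.one_apply]
    · simp
  · intro t _ ht
    have : ∃ k, k ≠ l ∧ s k ≠ t k := by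
      by_contra! h
      apply ht
      rw [Finset.mem_map]
      refine ⟨t l, Finset.mem_univ _, ?_⟩
      ext k
      by_cases hk : k = l
      · subst hk; simp
      · simp [hk, h k hk]
    obtain ⟨k, hk, hst⟩ := this
    rw [siteOp, tensorOp, Matrix.of_apply,
      Finset.prod_eq_zero (Finset.mem_univ k) (by simp [hk, hst]), zero_mul]

theorem siteOp_pauliZ_mulVec {n : ℕ} (l : Fin n) (ψ : QVec n) (s : Config n) :
    (siteOp pauliZ l *ᵥ ψ) s = (if s l = 0 then 1 else -1) * ψ s := by
  rw [siteOp_mulVec]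
  have h := Function.update_eq_self l s
  rcases Fin.exists_fin_two.mp ⟨s l, rfl⟩ with h0 | h0 <;> rw [h0] at h <;>
    simp [pauliZ, h0, h]

theorem totalSz_mulVec {n : ℕ} (ψ : QVec n) (s : Config n) :
    (totalSz n *ᵥ ψ) s = (2 * upCount s - n : ℂ) * ψ s := by
  rw [totalSz, Matrix.sum_mulVec, Finset.sum_apply]
  simp_rw [siteOp_pauliZ_mulVec]
  rw [← Finset.sum_mul]
  congr 1
  have (l : Fin n) : (if s l = 0 then 1 else -1 : ℂ) = 2 * (if s l = 0 then 1 else 0) - 1 := by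
    split_ifs <;> norm_num
  simp_rw [this]
  rw [Finset.sum_sub_distrib, ← Finset.mul_sum, Finset.sum_boole]
  simp [upCount, upSet]

theorem ne_add_one {n : ℕ} [NeZero n] (hn : 2 ≤ n) (l : Fin n) : l ≠ l + 1 := by
  have : Nontrivial (Fin n) := Fin.nontrivial_iff_two_le.mpr hn
  intro h
  have h1 : (1 : Fin n) = 0 := by simpa using h.symm
  have h2 : 1 % n = 0 % n := congrArg Fin.val h1
  rw [Nat.mod_eq_of_lt (by omega), Nat.zero_mod] at h2
  exact one_ne_zero h2

theorem bond_mulVec {n : ℕ} [NeZero n] (hn : 2 ≤ n) (l : Fin n) (ψ : QVec n) (s : Config n) :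
    ((siteOp pauliX l * siteOp pauliX (l + 1)) *ᵥ ψ) s
      + ((siteOp pauliY l * siteOp pauliY (l + 1)) *ᵥ ψ) s
      = 2 * if s l ≠ s (l + 1) then ψ (bondSwap l s) else 0 := by
  have hl := ne_add_one hn l
  have hb : bondSwap l s = Function.update (Function.update s l (s (l + 1))) (l + 1) (s l) := by
    rw [bondSwap, Equiv.comp_swap_eq_update]
    exact Function.update_comm hl.symm _ _ _
  simp only [← Matrix.mulVec_mulVec, siteOp_mulVec, Fin.sum_univ_two,
    Function.update_of_ne hl.symm, hb]
  rcases Fin.exists_fin_two.mp ⟨s l, rfl⟩ with h0 | h0 <;>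
  rcases Fin.exists_fin_two.mp ⟨s (l + 1), rfl⟩ with h1 | h1 <;>
  simp [pauliX, pauliY, h0, h1, ← mul_assoc] <;> ring

theorem hamXX_mulVec {n : ℕ} [NeZero n] (hn : 2 ≤ n) (J h : ℝ) (ψ : QVec n) (s : Config n) :
    (hamXX n J h *ᵥ ψ) s = 2 * J * hop ψ s + h * (2 * upCount s - n) * ψ s := by
  have hz := totalSz_mulVec ψ s
  rw [totalSz, Matrix.sum_mulVec, Finset.sum_apply] at hz
  rw [hamXX, Matrix.sum_mulVec, Finset.sum_apply]
  simp only [Matrix.add_mulVec, Matrix.smul_mulVec, Pi.add_apply, Pi.smul_apply, smul_eq_mul]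
  rw [Finset.sum_add_distrib, ← Finset.mul_sum, hz, hop]
  simp_rw [← mul_add, bond_mulVec hn]
  rw [← Finset.mul_sum, ← Finset.mul_sum]
  ring

/-! ### The explicit ground-state wave function -/

/-- The angle `π l / n` of the site `l`. -/
def siteAngle {n : ℕ} (l : Fin n) : ℝ := Real.pi * l / n

/-- Half the chord between two sites of the ring, placed on the unit circle. -/
def chord {n : ℕ} (i j : Fin n) : ℝ := |Real.sin (siteAngle i - siteAngle j)|

/-- The product of the chords over all unordered pairs of sites in `A`, encoded as the square root
of the product over ordered pairs. -/
def chordProd {n : ℕ} (A : Finset (Fin n)) : ℝ := √(∏ p ∈ A.offDiag, chord p.1 p.2)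

theorem chord_comm {n : ℕ} (i j : Fin n) : chord i j = chord j i := by
  rw [chord, chord, ← neg_sub, Real.sin_neg, abs_neg]

theorem siteAngle_sub_mem {n : ℕ} {i j : Fin n} (h : j < i) :
    Real.pi / n ≤ siteAngle i - siteAngle j ∧
      siteAngle i - siteAngle j + Real.pi / n ≤ Real.pi := by
  have hi := i.isLt
  have hn : (0 : ℝ) < n := by exact_mod_cast (by omega : 0 < n)
  have hd : siteAngle i - siteAngle j = Real.pi / n * ((i : ℝ) - j) := by
    rw [siteAngle, siteAngle]; ring
  have h1 : (j : ℝ) + 1 ≤ i := by exact_mod_cast h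
  have h2 : (i : ℝ) + 1 ≤ n := by exact_mod_cast hi
  have h3 : (0 : ℝ) ≤ j := Nat.cast_nonneg _
  have hp : 0 < Real.pi / n := div_pos Real.pi_pos hn
  have hpn : Real.pi / n * n = Real.pi := by field_simp
  rw [hd]
  constructor
  · nlinarith
  · nlinarith

theorem sin_siteAngle_sub_pos {n : ℕ} {i j : Fin n} (h : j < i) :
    0 < Real.sin (siteAngle i - siteAngle j) := by
  have hn : (0 : ℝ) < n := by exact_mod_cast (Nat.zero_lt_of_lt i.isLt)
  have hp : 0 < Real.pi / n := div_pos Real.pi_pos hn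
  obtain ⟨h1, h2⟩ := siteAngle_sub_mem h
  exact Real.sin_pos_of_pos_of_lt_pi (by linarith) (by linarith)

theorem sin_siteAngle_sub_ne_zero {n : ℕ} {i j : Fin n} (h : i ≠ j) :
    Real.sin (siteAngle i - siteAngle j) ≠ 0 := by
  rcases h.lt_or_gt with h | h
  · rw [← neg_sub, Real.sin_neg]
    exact neg_ne_zero.mpr (sin_siteAngle_sub_pos h).ne'
  · exact (sin_siteAngle_sub_pos h).ne'

theorem chord_pos {n : ℕ} {i j : Fin n} (h : i ≠ j) : 0 < chord i j :=
  abs_pos.mpr (sin_siteAngle_sub_ne_zero h)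

/-- Moving one of two particles by one site does not make it pass the other. -/
theorem sin_siteAngle_sub_add_div_nonneg {n : ℕ} {i j : Fin n} (h : i ≠ j) {a : ℝ}
    (ha : |a| ≤ Real.pi / n) :
    0 ≤ Real.sin (siteAngle i - siteAngle j + a) / Real.sin (siteAngle i - siteAngle j) := by
  obtain ⟨ha1, ha2⟩ := abs_le.mp ha
  rcases h.lt_or_gt with h | h
  · obtain ⟨h1, h2⟩ := siteAngle_sub_mem h
    rw [show siteAngle i - siteAngle j + a = -(siteAngle j - siteAngle i - a) by ring,
      ← neg_sub (siteAngle j), Real.sin_neg, Real.sin_neg, neg_div_neg_eq]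
    exact div_nonneg (Real.sin_nonneg_of_nonneg_of_le_pi (by linarith) (by linarith))
      (sin_siteAngle_sub_pos h).le
  · obtain ⟨h1, h2⟩ := siteAngle_sub_mem h
    exact div_nonneg (Real.sin_nonneg_of_nonneg_of_le_pi (by linarith) (by linarith))
      (sin_siteAngle_sub_pos h).le

/-- Around the end of the ring the angle jumps by `π`, which the modulus does not see. -/
theorem abs_sin_siteAngle_add_one_sub {n : ℕ} [NeZero n] (l : Fin n) (x : ℝ) :
    |Real.sin (siteAngle (l + 1) - x)| = |Real.sin (siteAngle l + Real.pi / n - x)| := by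
  have hn : (n : ℝ) ≠ 0 := NeZero.ne _
  have hval : ((l + 1 : Fin n) : ℕ) = (l + 1) % n := by
    rw [Fin.val_add]
    change (l + 1 % n) % n = _
    rw [Nat.add_mod_mod]
  by_cases h : (l : ℕ) + 1 < n
  · rw [Nat.mod_eq_of_lt h] at hval
    rw [siteAngle, siteAngle, hval]
    congr 2
    push_cast; ring
  · have hl : (l : ℕ) + 1 = n := by have := l.isLt; omega
    rw [hl, Nat.mod_self] at hval
    have : siteAngle l + Real.pi / n = Real.pi := by
      have hc : (l : ℝ) + 1 = n := by exact_mod_cast hl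
      rw [siteAngle, ← add_div, ← mul_add_one, hc]
      field_simp
    rw [this, siteAngle, hval, Real.sin_pi_sub, Nat.cast_zero, mul_zero, zero_div, zero_sub,
      Real.sin_neg, abs_neg]

theorem chord_add_one_div {n : ℕ} [NeZero n] {l j : Fin n} (h : l ≠ j) :
    chord (l + 1) j / chord l j
      = Real.sin (siteAngle l - siteAngle j + Real.pi / n)
        / Real.sin (siteAngle l - siteAngle j) := by
  have hp : 0 ≤ Real.pi / n := div_nonneg Real.pi_pos.le (Nat.cast_nonneg n)
  rw [chord, chord, abs_sin_siteAngle_add_one_sub, ← abs_div, add_sub_right_comm, abs_of_nonneg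
    (sin_siteAngle_sub_add_div_nonneg h (abs_of_nonneg hp).le)]

theorem chord_div_add_one {n : ℕ} [NeZero n] {l j : Fin n} (h : l + 1 ≠ j) :
    chord l j / chord (l + 1) j
      = Real.sin (siteAngle (l + 1) - siteAngle j + -(Real.pi / n))
        / Real.sin (siteAngle (l + 1) - siteAngle j) := by
  have hp : 0 ≤ Real.pi / n := div_nonneg Real.pi_pos.le (Nat.cast_nonneg n)
  have hl : |Real.sin (siteAngle l - siteAngle j)|
      = |Real.sin (siteAngle (l + 1) - siteAngle j + -(Real.pi / n))| := by
    rw [show siteAngle (l + 1) - siteAngle j + -(Real.pi / n)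
      = siteAngle (l + 1) - (siteAngle j + Real.pi / n) by ring, abs_sin_siteAngle_add_one_sub]
    congr 2; ring
  rw [chord, chord, hl, ← abs_div, abs_of_nonneg
    (sin_siteAngle_sub_add_div_nonneg h (by rw [abs_neg, abs_of_nonneg hp]))]

theorem chordProd_pos {n : ℕ} (A : Finset (Fin n)) : 0 < chordProd A :=
  Real.sqrt_pos.mpr <| Finset.prod_pos fun _ hp => chord_pos (Finset.mem_offDiag.mp hp).2.2

theorem chordProd_insert {n : ℕ} {A : Finset (Fin n)} {l : Fin n} (h : l ∉ A) :
    chordProd (insert l A) = chordProd A * ∏ j ∈ A, chord l j := by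
  have hnn : 0 ≤ ∏ j ∈ A, chord l j := Finset.prod_nonneg fun _ _ => abs_nonneg _
  rw [chordProd, chordProd, Finset.offDiag_insert h, Finset.prod_union, Finset.prod_union,
    Finset.prod_product, Finset.prod_product_right, Finset.prod_singleton, Finset.prod_singleton]
  · simp_rw [chord_comm _ l]
    rw [mul_assoc, Real.sqrt_mul' _ (mul_self_nonneg _), Real.sqrt_mul_self hnn]
  · rw [Finset.disjoint_left]
    rintro ⟨a, b⟩ h1 h2
    simp only [Finset.mem_offDiag, Finset.mem_product, Finset.mem_singleton] at h1 h2
    exact h (h2.1 ▸ h1.1)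
  · rw [Finset.disjoint_left]
    rintro ⟨a, b⟩ h1 h2
    simp only [Finset.mem_offDiag, Finset.mem_product, Finset.mem_singleton,
      Finset.mem_union] at h1 h2
    rcases h1 with h1 | h1
    · exact h (h2.2 ▸ h1.2.1)
    · exact h (h2.2 ▸ h1.2)

theorem chordProd_insert_erase {n : ℕ} {A : Finset (Fin n)} {l k : Fin n} (hl : l ∈ A)
    (hk : k ∉ A) :
    chordProd (insert k (A.erase l)) = chordProd A * ∏ j ∈ A.erase l, chord k j / chord l j := by
  have h1 := chordProd_insert (Finset.notMem_erase l A)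
  rw [Finset.insert_erase hl] at h1
  have h2 : ∏ j ∈ A.erase l, chord l j ≠ 0 := Finset.prod_ne_zero_iff.mpr fun j hj =>
    (chord_pos (Finset.ne_of_mem_erase hj).symm).ne'
  rw [chordProd_insert (fun h => hk (Finset.mem_of_mem_erase h)), h1, Finset.prod_div_distrib]
  field_simp

/-- The positive amplitude of a configuration in the ground state of its spin sector. -/
def weight {n : ℕ} (s : Config n) : ℝ := chordProd (upSet s)

theorem weight_pos {n : ℕ} (s : Config n) : 0 < weight s := chordProd_pos _

theorem upSet_bondSwap {n : ℕ} [NeZero n] {s : Config n} {l : Fin n} (h0 : s l = 0)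
    (h1 : s (l + 1) ≠ 0) : upSet (bondSwap l s) = insert (l + 1) ((upSet s).erase l) := by
  have hl : l ≠ l + 1 := fun h => h1 (h ▸ h0)
  ext k
  simp only [mem_upSet, bondSwap, Function.comp, Finset.mem_insert, Finset.mem_erase]
  rcases eq_or_ne k l with rfl | hk
  · simp [h1, hl]
  rcases eq_or_ne k (l + 1) with rfl | hk1
  · simp [h0]
  · simp [Equiv.swap_apply_of_ne_of_ne hk hk1, hk, hk1]

theorem upSet_bondSwap' {n : ℕ} [NeZero n] {s : Config n} {l : Fin n} (h0 : s l ≠ 0)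
    (h1 : s (l + 1) = 0) : upSet (bondSwap l s) = insert l ((upSet s).erase (l + 1)) := by
  have hl : l + 1 ≠ l := fun h => h0 (h ▸ h1)
  ext k
  simp only [mem_upSet, bondSwap, Function.comp, Finset.mem_insert, Finset.mem_erase]
  rcases eq_or_ne k (l + 1) with rfl | hk1
  · simp [h0, hl]
  rcases eq_or_ne k l with rfl | hk
  · simp [h1]
  · simp [Equiv.swap_apply_of_ne_of_ne hk hk1, hk, hk1]

/-- The absolute value of the eigenvalue of `hop` on the ground state with `N` up spins. -/
def hopEnergy (n N : ℕ) : ℝ := 2 * (Real.sin (Real.pi * N / n) / Real.sin (Real.pi / n))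

theorem sin_pi_div_pos {n : ℕ} (hn : 2 ≤ n) : 0 < Real.sin (Real.pi / n) := by
  have h2 : (2 : ℝ) ≤ n := by exact_mod_cast hn
  refine Real.sin_pos_of_pos_of_lt_pi (div_pos Real.pi_pos (by linarith)) ?_
  rw [div_lt_iff₀ (by linarith)]
  nlinarith [Real.pi_pos]

/-- The eigenvalue equation for the positive amplitudes. Hops onto an occupied site may be
included in the sum, since the chord of coinciding sites vanishes; the hops to the right and those
to the left then each give one instance of `sum_prod_sin_sub_add_div`. -/
theorem sum_weight_bondSwap {n : ℕ} [NeZero n] (hn : 2 ≤ n) (s : Config n) :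
    ∑ l : Fin n, (if s l ≠ s (l + 1) then weight (bondSwap l s) else 0)
      = hopEnergy n (upCount s) * weight s := by
  -- Relative change of the weight when the particle at `l` moves by the angle `a`.
  let R (a : ℝ) (l : Fin n) : ℝ := if l ∈ upSet s then ∏ j ∈ (upSet s).erase l,
    Real.sin (siteAngle l - siteAngle j + a) / Real.sin (siteAngle l - siteAngle j) else 0
  have hR1 (l : Fin n) (h0 : s l = 0) :
      R (Real.pi / n) l = ∏ j ∈ (upSet s).erase l, chord (l + 1) j / chord l j := by
    simp only [R]
    rw [if_pos (mem_upSet.mpr h0)]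
    exact Finset.prod_congr rfl fun j hj =>
      (chord_add_one_div (Finset.ne_of_mem_erase hj).symm).symm
  have hR2 (l : Fin n) (h0 : s (l + 1) = 0) :
      R (-(Real.pi / n)) (l + 1)
        = ∏ j ∈ (upSet s).erase (l + 1), chord l j / chord (l + 1) j := by
    simp only [R]
    rw [if_pos (mem_upSet.mpr h0)]
    exact Finset.prod_congr rfl fun j hj =>
      (chord_div_add_one (Finset.ne_of_mem_erase hj).symm).symm
  have hterm (l : Fin n) : (if s l ≠ s (l + 1) then weight (bondSwap l s) else 0)
      = weight s * R (Real.pi / n) l + weight s * R (-(Real.pi / n)) (l + 1) := by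
    have hl := ne_add_one hn l
    rcases eq_or_ne (s l) 0 with h0 | h0 <;> rcases eq_or_ne (s (l + 1)) 0 with h1 | h1
    · rw [if_neg (by simp [h0, h1]), hR1 l h0, hR2 l h1,
        Finset.prod_eq_zero (i := l + 1) (by simp [h1, hl.symm]) (by simp [chord]),
        Finset.prod_eq_zero (i := l) (by simp [h0, hl]) (by simp [chord])]
      simp
    · rw [if_pos (by rw [h0]; exact h1.symm), weight, upSet_bondSwap h0 h1,
        chordProd_insert_erase (by simpa using h0) (by simpa using h1), hR1 l h0]
      simp [R, h1, weight]
    · rw [if_pos (by rw [h1]; exact h0), weight, upSet_bondSwap' h0 h1,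
        chordProd_insert_erase (by simpa using h1) (by simpa using h0), hR2 l h1]
      simp [R, h0, weight]
    · rw [if_neg (by rw [Fin.eq_one_of_ne_zero _ h0, Fin.eq_one_of_ne_zero _ h1]; simp)]
      simp [R, h0, h1]
  have hsum (a : ℝ) (ha : Real.sin a ≠ 0) :
      ∑ l, R a l = Real.sin (upCount s * a) / Real.sin a := by
    rw [upCount, ← sum_prod_sin_sub_add_div (upSet s) siteAngle a
      (fun i _ j _ h => sin_siteAngle_sub_ne_zero h) ha]
    simp only [R]
    rw [Finset.sum_ite_mem, Finset.univ_inter]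
  have hs := (sin_pi_div_pos hn).ne'
  have hshift : ∑ l, R (-(Real.pi / n)) (l + 1) = ∑ l, R (-(Real.pi / n)) l :=
    Equiv.sum_comp (Equiv.addRight (1 : Fin n)) (R (-(Real.pi / n)))
  simp_rw [hterm]
  rw [Finset.sum_add_distrib, ← Finset.mul_sum, ← Finset.mul_sum,
    hshift, hsum _ hs,
    hsum _ (by rw [Real.sin_neg]; exact neg_ne_zero.mpr hs), mul_neg, Real.sin_neg, Real.sin_neg,
    neg_div_neg_eq, hopEnergy, mul_comm (upCount s : ℝ), div_mul_eq_mul_div]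
  ring

/-! ### The ground-state transformation -/

/-- The sublattice sign `∏ (-1) ^ l` over the occupied sites `l`. -/
def stagger {n : ℕ} (s : Config n) : ℝ := ∏ l ∈ upSet s, (-1) ^ (l : ℕ)

/-- The ground states of all spin sectors in one vector: its restriction to the configurations
with `N` up spins is the (unnormalized, real) ground state of that sector. -/
def refVec {n : ℕ} (s : Config n) : ℝ := stagger s * weight s

theorem stagger_mul_self {n : ℕ} (s : Config n) : stagger s * stagger s = 1 := by
  rw [stagger, ← Finset.prod_mul_distrib]
  exact Finset.prod_eq_one fun l _ => by rw [← mul_pow]; norm_num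

theorem stagger_ne_zero {n : ℕ} (s : Config n) : stagger s ≠ 0 :=
  left_ne_zero_of_mul_eq_one (stagger_mul_self s)

theorem refVec_ne_zero {n : ℕ} (s : Config n) : refVec s ≠ 0 :=
  mul_ne_zero (stagger_ne_zero s) (weight_pos s).ne'

/-- On an even ring neighbouring sites have opposite sublattice signs, also across the end. -/
theorem neg_one_pow_add_one {n : ℕ} [NeZero n] (hn : Even n) (l : Fin n) :
    (-1 : ℝ) ^ ((l + 1 : Fin n) : ℕ) = -(-1) ^ (l : ℕ) := by
  have hval : ((l + 1 : Fin n) : ℕ) = (l + 1) % n := by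
    rw [Fin.val_add]
    change (l + 1 % n) % n = _
    rw [Nat.add_mod_mod]
  rw [hval, ← neg_one_mul ((-1 : ℝ) ^ (l : ℕ)), ← pow_succ']
  conv_rhs => rw [← Nat.mod_add_div (l + 1) n, pow_add, pow_mul, hn.neg_one_pow, one_pow, mul_one]

theorem stagger_bondSwap {n : ℕ} [NeZero n] (hn : Even n) {s : Config n} {l : Fin n}
    (h : s l ≠ s (l + 1)) : stagger (bondSwap l s) = -stagger s := by
  rcases eq_or_ne (s l) 0 with h0 | h0
  · have h1 : s (l + 1) ≠ 0 := fun h1 => h (h0.trans h1.symm)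
    rw [stagger, upSet_bondSwap h0 h1, Finset.prod_insert (by simp [h1]),
      neg_one_pow_add_one hn, neg_mul, Finset.mul_prod_erase _ (fun l : Fin n => (-1 : ℝ) ^ (l : ℕ))
        (by simpa using h0), stagger]
  · have h1 : s (l + 1) = 0 := by
      by_contra h1
      exact h ((Fin.eq_one_of_ne_zero _ h0).trans (Fin.eq_one_of_ne_zero _ h1).symm)
    have hsgn : (-1 : ℝ) ^ (l : ℕ) = -(-1) ^ ((l + 1 : Fin n) : ℕ) := by
      rw [neg_one_pow_add_one hn, neg_neg]
    rw [stagger, upSet_bondSwap' h0 h1, Finset.prod_insert (by simp [h0]), hsgn, neg_mul,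
      Finset.mul_prod_erase _ (fun l : Fin n => (-1 : ℝ) ^ (l : ℕ)) (by simpa using h1), stagger]

/-- `hop + hopEnergy` in terms of the quotient `χ` of a vector by `refVec`: a weighted graph
Laplacian. -/
theorem hop_refVec_mul {n : ℕ} [NeZero n] (hn2 : 2 ≤ n) (hn : Even n) (χ : QVec n) (s : Config n) :
    hop (fun t => refVec t * χ t) s + hopEnergy n (upCount s) * (refVec s * χ s)
      = stagger s * ∑ l : Fin n,
        if s l ≠ s (l + 1) then weight (bondSwap l s) * (χ s - χ (bondSwap l s)) else 0 := by
  have hw : (hopEnergy n (upCount s) : ℂ) * weight s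
      = ∑ l : Fin n, if s l ≠ s (l + 1) then (weight (bondSwap l s) : ℂ) else 0 := by
    rw [← Complex.ofReal_mul, ← sum_weight_bondSwap hn2 s]
    push_cast
    exact Finset.sum_congr rfl fun l _ => by split_ifs <;> simp
  have : (hopEnergy n (upCount s) : ℂ) * (refVec s * χ s)
      = stagger s * χ s * (hopEnergy n (upCount s) * weight s) := by
    rw [refVec]; push_cast; ring
  rw [this, hw, hop, Finset.mul_sum, Finset.mul_sum, ← Finset.sum_add_distrib]
  refine Finset.sum_congr rfl fun l _ => ?_
  split_ifs with h
  · rw [refVec, stagger_bondSwap hn h]; push_cast; ring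
  · simp

/-- The Dirichlet form of the ground-state transformation. -/
def dirichlet {n : ℕ} [NeZero n] (χ : QVec n) : ℝ :=
  ∑ l : Fin n, ∑ s : Config n, if s l ≠ s (l + 1) then
    weight s * weight (bondSwap l s) * Complex.normSq (χ s - χ (bondSwap l s)) else 0

theorem sum_star_mul_hop {n : ℕ} [NeZero n] (hn2 : 2 ≤ n) (hn : Even n) (χ : QVec n) :
    2 * ∑ s : Config n, star (refVec s * χ s)
      * (hop (fun t => refVec t * χ t) s + hopEnergy n (upCount s) * (refVec s * χ s))
      = dirichlet χ := by
  let T (l : Fin n) (s : Config n) : ℂ := if s l ≠ s (l + 1) then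
    weight s * weight (bondSwap l s) * (star (χ s) * (χ s - χ (bondSwap l s))) else 0
  have h1 (s : Config n) : star (refVec s * χ s)
      * (hop (fun t => refVec t * χ t) s + hopEnergy n (upCount s) * (refVec s * χ s))
      = ∑ l, T l s := by
    have hst : (stagger s : ℂ) * stagger s = 1 := by exact_mod_cast stagger_mul_self s
    rw [hop_refVec_mul hn2 hn, ← mul_assoc, Finset.mul_sum]
    refine Finset.sum_congr rfl fun l _ => ?_
    simp only [T]
    split_ifs
    · simp only [refVec, star_mul', Complex.star_def, Complex.conj_ofReal, Complex.ofReal_mul]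
      linear_combination (weight s * (starRingEnd ℂ) (χ s) * weight (bondSwap l s)
        * (χ s - χ (bondSwap l s)) : ℂ) * hst
    · simp
  have hbij (l : Fin n) : ∑ s, T l (bondSwap l s) = ∑ s, T l s :=
    Function.Bijective.sum_comp
      (Function.Involutive.bijective (fun s => bondSwap_bondSwap l s)) (T l)
  have h2 (l : Fin n) : 2 * ∑ s, T l s = ∑ s : Config n, (if s l ≠ s (l + 1) then
      (weight s * weight (bondSwap l s) * Complex.normSq (χ s - χ (bondSwap l s)) : ℝ)
      else 0 : ℝ) := by
    -- Average the term of a configuration with that of its image under the exchange.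
    rw [two_mul]
    nth_rewrite 2 [← hbij]
    rw [← Finset.sum_add_distrib]
    push_cast
    refine Finset.sum_congr rfl fun s _ => ?_
    have hsw : (bondSwap l s l ≠ bondSwap l s (l + 1)) ↔ s l ≠ s (l + 1) := by
      simp [bondSwap, eq_comm]
    simp only [T, hsw, bondSwap_bondSwap]
    split_ifs
    · push_cast
      rw [Complex.normSq_eq_conj_mul_self]
      simp only [Complex.star_def, map_sub]
      ring
    · simp
  simp_rw [h1]
  rw [Finset.sum_comm, Finset.mul_sum]
  simp_rw [h2]
  rw [dirichlet]
  push_cast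
  rfl

/-! ### Sector energies and the ground space -/

theorem exists_perm_comp_eq {n : ℕ} {s t : Config n} (h : upCount s = upCount t) :
    ∃ σ : Equiv.Perm (Fin n), t ∘ σ = s := by
  have hz : Fintype.card {a // s a = 0} = Fintype.card {b // t b = 0} := by
    rw [Fintype.card_subtype, Fintype.card_subtype]; exact h
  have hfib (c : Fin 2) : Nonempty ({a // s a = c} ≃ {b // t b = c}) := by
    rw [← Fintype.card_eq]
    rcases eq_or_ne c 0 with rfl | hc
    · exact hz
    · have hiff (u : Config n) (a : Fin n) : u a = c ↔ ¬ u a = 0 := by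
        have h1 := Fin.eq_one_of_ne_zero c hc
        subst h1
        exact ⟨fun h => h ▸ hc, Fin.eq_one_of_ne_zero _⟩
      simp_rw [hiff]
      exact Fintype.card_compl_eq_card_compl _ _ hz
  exact ⟨Equiv.ofFiberEquiv fun c => (hfib c).some, funext fun a => Equiv.ofFiberEquiv_map _ a⟩

/-- Adjacent transpositions connect all configurations with the same number of up spins. -/
theorem eq_of_forall_bondSwap {n : ℕ} [NeZero n] {X : Type*} (χ : Config n → X)
    (hχ : ∀ l s, χ (bondSwap l s) = χ s) {s t : Config n} (h : upCount s = upCount t) :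
    χ s = χ t := by
  obtain ⟨σ, rfl⟩ := exists_perm_comp_eq h
  obtain ⟨m, rfl⟩ := Nat.exists_eq_succ_of_ne_zero (NeZero.ne n)
  have hσ : σ ∈ Submonoid.closure
      (Set.range fun i : Fin m => Equiv.swap i.castSucc i.succ) := by
    rw [Equiv.Perm.mclosure_swap_castSucc_succ]; trivial
  induction hσ using Submonoid.closure_induction_right with
  | one => rfl
  | mul_right σ _ τ hτ ih =>
    obtain ⟨i, rfl⟩ := hτ
    have h1 : i.castSucc + 1 = i.succ := by simp
    have := hχ i.castSucc (t ∘ σ)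
    rw [bondSwap, h1] at this
    rw [← ih (upCount_comp_perm _ _)]
    exact this

/-- The ground energy of the sector with `N` up spins. -/
def sectorEnergy (n : ℕ) (J h : ℝ) (N : ℕ) : ℝ := h * (2 * N - n) - 2 * J * hopEnergy n N

/-- The combination of the ground states of the spin sectors with coefficients `c`. -/
def sectorVec (n : ℕ) (c : ℕ → ℂ) : QVec n := fun s => refVec s * c (upCount s)

theorem hamXX_mulVec_sectorVec {n : ℕ} [NeZero n] (hn2 : 2 ≤ n) (hn : Even n) (J h : ℝ)
    (c : ℕ → ℂ) (s : Config n) :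
    (hamXX n J h *ᵥ sectorVec n c) s = sectorEnergy n J h (upCount s) * sectorVec n c s := by
  have := hop_refVec_mul hn2 hn (fun s => c (upCount s)) s
  simp only [upCount_bondSwap, sub_self, mul_zero, ite_self, Finset.sum_const_zero] at this
  rw [hamXX_mulVec hn2, sectorEnergy]
  push_cast
  unfold sectorVec
  linear_combination 2 * J * this

/-- The Dirichlet form bounds every eigenvalue from below by the sector energies, and forces
an eigenvector for the lowest of them to be constant relative to `refVec` on each sector. -/
theorem eigenvector_of_le_sectorEnergy {n : ℕ} [NeZero n] (hn2 : 2 ≤ n) (hn : Even n) {J h E : ℝ}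
    (hJ : 0 < J) (hE : ∀ s : Config n, E ≤ sectorEnergy n J h (upCount s)) {ψ : QVec n}
    (hψ : hamXX n J h *ᵥ ψ = (E : ℂ) • ψ) :
    (∀ s, ψ s ≠ 0 → sectorEnergy n J h (upCount s) = E) ∧ ∃ c : ℕ → ℂ, ψ = sectorVec n c := by
  let χ : QVec n := fun s => ψ s / refVec s
  have href (s : Config n) : (refVec s : ℂ) ≠ 0 := by exact_mod_cast refVec_ne_zero s
  have hψχ : ψ = fun s => refVec s * χ s := by
    funext s; simp only [χ]; rw [mul_div_cancel₀ _ (href s)]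
  have hform := sum_star_mul_hop hn2 hn χ
  have hpt (s : Config n) : 2 * J * (hop ψ s + hopEnergy n (upCount s) * ψ s)
      = (E - sectorEnergy n J h (upCount s)) * ψ s := by
    have := congrFun hψ s
    rw [hamXX_mulVec hn2, Pi.smul_apply, smul_eq_mul] at this
    rw [sectorEnergy]; push_cast
    linear_combination this
  -- The left side is nonnegative and the right side nonpositive, so both vanish termwise.
  have hsum : J * dirichlet χ
      = ∑ s : Config n, (E - sectorEnergy n J h (upCount s)) * Complex.normSq (ψ s) := by
    apply Complex.ofReal_injective
    rw [Complex.ofReal_mul, ← hform, ← mul_assoc, Finset.mul_sum]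
    push_cast
    refine Finset.sum_congr rfl fun s _ => ?_
    rw [Complex.normSq_eq_conj_mul_self, ← hψχ]
    have h1 : (refVec s : ℂ) * χ s = ψ s := (congrFun hψχ s).symm
    rw [h1, Complex.star_def]
    linear_combination (starRingEnd ℂ) (ψ s) * hpt s
  have hterm (l : Fin n) (s : Config n) : 0 ≤ if s l ≠ s (l + 1) then
      weight s * weight (bondSwap l s) * Complex.normSq (χ s - χ (bondSwap l s)) else 0 := by
    split_ifs
    · exact mul_nonneg (mul_nonneg (weight_pos _).le (weight_pos _).le) (Complex.normSq_nonneg _)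
    · exact le_rfl
  have hD : 0 ≤ dirichlet χ :=
    Finset.sum_nonneg fun l _ => Finset.sum_nonneg fun s _ => hterm l s
  have hneg (s : Config n) :
      (E - sectorEnergy n J h (upCount s)) * Complex.normSq (ψ s) ≤ 0 :=
    mul_nonpos_of_nonpos_of_nonneg (sub_nonpos.mpr (hE s)) (Complex.normSq_nonneg _)
  have hS := Finset.sum_nonpos fun s (_ : s ∈ Finset.univ) => hneg s
  have hD0 : dirichlet χ = 0 := by
    have : 0 ≤ J * dirichlet χ := mul_nonneg hJ.le hD
    have h0 : J * dirichlet χ = 0 := le_antisymm (hsum ▸ hS) this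
    exact (mul_eq_zero.mp h0).resolve_left hJ.ne'
  rw [hD0, mul_zero] at hsum
  have hz := (Finset.sum_eq_zero_iff_of_nonpos fun s _ => hneg s).mp hsum.symm
  refine ⟨fun s hs => ?_, ?_⟩
  · have := (mul_eq_zero.mp (hz s (Finset.mem_univ s))).resolve_right
      (by rwa [Complex.normSq_eq_zero])
    linarith
  have hχ (l : Fin n) (s : Config n) : χ (bondSwap l s) = χ s := by
    by_cases h : s l = s (l + 1)
    · rw [bondSwap, Equiv.comp_swap_eq_update, h, Function.update_eq_self, ← h,
        Function.update_eq_self]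
    · have h1 := (Finset.sum_eq_zero_iff_of_nonneg
        fun l _ => Finset.sum_nonneg fun s _ => hterm l s).mp hD0 l (Finset.mem_univ l)
      have h2 := (Finset.sum_eq_zero_iff_of_nonneg fun s _ => hterm l s).mp h1 s
        (Finset.mem_univ s)
      rw [if_pos h] at h2
      have h3 := (mul_eq_zero.mp h2).resolve_left
        (mul_pos (weight_pos _) (weight_pos _)).ne'
      exact (sub_eq_zero.mp (Complex.normSq_eq_zero.mp h3)).symm
  classical
  refine ⟨fun N => if h : ∃ s : Config n, upCount s = N then χ h.choose else 0, ?_⟩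
  funext s
  have hex : ∃ t : Config n, upCount t = upCount s := ⟨s, rfl⟩
  rw [sectorVec, dif_pos hex, eq_of_forall_bondSwap χ hχ hex.choose_spec, hψχ]

theorem exists_upCount_eq {n N : ℕ} (h : N ≤ n) : ∃ s : Config n, upCount s = N := by
  refine ⟨fun l => if (l : ℕ) < N then 0 else 1, ?_⟩
  have : upSet (fun l : Fin n => if (l : ℕ) < N then (0 : Fin 2) else 1)
      = Finset.univ.filter fun l : Fin n => (l : ℕ) < N := by
    ext l; simp
  rw [upCount, this, Fin.card_filter_val_lt, min_eq_right h]

theorem sectorVec_single_ne_zero {n N : ℕ} (h : N ≤ n) : sectorVec n (Pi.single N 1) ≠ 0 := by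
  obtain ⟨s, hs⟩ := exists_upCount_eq h
  intro h0
  have := congrFun h0 s
  simp [sectorVec, hs, refVec_ne_zero] at this

/-- `N₀` labels a spin sector of lowest energy. -/
def IsMinSector (n : ℕ) (J h : ℝ) (N₀ : ℕ) : Prop :=
  N₀ ≤ n ∧ ∀ N ≤ n, sectorEnergy n J h N₀ ≤ sectorEnergy n J h N

theorem exists_isMinSector (n : ℕ) (J h : ℝ) : ∃ N, IsMinSector n J h N := by
  obtain ⟨N, hN, hmin⟩ := Finset.exists_min_image (Finset.range (n + 1)) (sectorEnergy n J h)
    ⟨0, by simp⟩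
  exact ⟨N, by simpa [Nat.lt_succ_iff] using hN,
    fun M h => hmin M (by simpa [Nat.lt_succ_iff] using h)⟩

theorem isLeast_energyLevels {n : ℕ} [NeZero n] (hn2 : 2 ≤ n) (hn : Even n) {J h : ℝ} (hJ : 0 < J)
    {N₀ : ℕ} (hN : IsMinSector n J h N₀) :
    IsLeast (energyLevels (hamXX n J h)) (sectorEnergy n J h N₀) := by
  constructor
  · refine Module.End.hasEigenvalue_of_hasEigenvector (x := sectorVec n (Pi.single N₀ 1))
      ⟨Module.End.mem_eigenspace_iff.mpr ?_, sectorVec_single_ne_zero hN.1⟩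
    funext s
    rw [Matrix.toLin'_apply, hamXX_mulVec_sectorVec hn2 hn, Pi.smul_apply, smul_eq_mul]
    by_cases hs : upCount s = N₀
    · rw [hs]
    · simp [sectorVec, hs]
  · intro E hE
    by_contra! hlt
    obtain ⟨ψ, hψ⟩ := Module.End.HasEigenvalue.exists_hasEigenvector hE
    have hmem := Module.End.mem_eigenspace_iff.mp hψ.1
    rw [Matrix.toLin'_apply] at hmem
    have hlow (s : Config n) := hN.2 _ (upCount_le s)
    have := (eigenvector_of_le_sectorEnergy hn2 hn hJ
      (fun s => hlt.le.trans (hlow s)) hmem).1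
    obtain ⟨s, hs⟩ := Function.ne_iff.mp hψ.2
    linarith [this s hs, hlow s]

theorem groundEnergy_hamXX {n : ℕ} [NeZero n] (hn2 : 2 ≤ n) (hn : Even n) {J h : ℝ} (hJ : 0 < J)
    {N₀ : ℕ} (hN : IsMinSector n J h N₀) :
    groundEnergy (hamXX n J h) = sectorEnergy n J h N₀ :=
  (isLeast_energyLevels hn2 hn hJ hN).csInf_eq

/-- The ground space consists of the combinations of the ground states of the lowest sectors. -/
theorem mem_groundSpace_hamXX {n : ℕ} [NeZero n] (hn2 : 2 ≤ n) (hn : Even n) {J h : ℝ}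
    (hJ : 0 < J) {ψ : QVec n} :
    ψ ∈ groundSpace (hamXX n J h) ↔
      ∃ c : ℕ → ℂ, (∀ N ≤ n, c N ≠ 0 → IsMinSector n J h N) ∧ ψ = sectorVec n c := by
  obtain ⟨N₀, hN⟩ := exists_isMinSector n J h
  rw [groundSpace, Module.End.mem_eigenspace_iff, Matrix.toLin'_apply,
    groundEnergy_hamXX hn2 hn hJ hN]
  constructor
  · intro hψ
    obtain ⟨h1, c, rfl⟩ := eigenvector_of_le_sectorEnergy hn2 hn hJ
      (fun s => hN.2 _ (upCount_le s)) hψ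
    refine ⟨c, fun N hNn hc => ⟨hNn, ?_⟩, rfl⟩
    obtain ⟨s, rfl⟩ := exists_upCount_eq hNn
    rw [h1 s (mul_ne_zero (by exact_mod_cast refVec_ne_zero s) hc)]
    exact hN.2
  · rintro ⟨c, hc, rfl⟩
    funext s
    rw [hamXX_mulVec_sectorVec hn2 hn, Pi.smul_apply, smul_eq_mul]
    by_cases hs : c (upCount s) = 0
    · simp [sectorVec, hs]
    · rw [le_antisymm ((hc _ (upCount_le s) hs).2 _ hN.1) (hN.2 _ (upCount_le s))]

/-! ### Comparison of the sector energies -/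

/-- `sin² (k a)` is superadditive in `k` while `k a ≤ π / 4`, because
`sin² ((k + 1) a) - sin² (k a) = sin ((2 k + 1) a) sin a`. -/
theorem nat_mul_sin_sq_le {a : ℝ} (ha : 0 < a) {k : ℕ} (hk : k * a ≤ Real.pi / 4) :
    k * Real.sin a ^ 2 ≤ Real.sin (k * a) ^ 2 ∧
      (2 ≤ k → k * Real.sin a ^ 2 < Real.sin (k * a) ^ 2) := by
  induction k with
  | zero => simp
  | succ k ih =>
    push_cast at hk ⊢
    have hka : k * a ≤ Real.pi / 4 := by nlinarith
    obtain ⟨ih1, -⟩ := ih hka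
    have hk0 : (0 : ℝ) ≤ k * a := by positivity
    have hid : Real.sin ((k + 1) * a) ^ 2 = Real.sin (k * a) ^ 2
        + Real.sin (2 * (k * a) + a) * Real.sin a := by
      rw [add_mul, one_mul, Real.sin_add, Real.sin_add, Real.sin_two_mul, Real.cos_two_mul]
      linear_combination Real.sin (k * a) ^ 2 * Real.sin_sq_add_cos_sq a
        - Real.sin a ^ 2 * Real.sin_sq_add_cos_sq (k * a)
    have hs : 0 < Real.sin a := Real.sin_pos_of_pos_of_lt_pi ha (by linarith [Real.pi_pos])
    rw [hid]
    constructor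
    · have : Real.sin a ≤ Real.sin (2 * (k * a) + a) :=
        Real.sin_le_sin_of_le_of_le_pi_div_two (by linarith) (by linarith) (by linarith)
      nlinarith
    · intro h2
      have hk1 : (1 : ℝ) ≤ k := by exact_mod_cast (by omega : 1 ≤ k)
      have : Real.sin a < Real.sin (2 * (k * a) + a) :=
        Real.sin_lt_sin_of_lt_of_le_pi_div_two (by linarith) (by linarith) (by nlinarith)
      nlinarith

theorem criticalAngle_bounds {n : ℕ} (hn : 2 ≤ n) :
    0 < Real.pi / (2 * n) ∧ Real.pi / (2 * n) ≤ Real.pi / 4 := by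
  have h2 : (2 : ℝ) ≤ n := by exact_mod_cast hn
  exact ⟨by have := Real.pi_pos; positivity,
    div_le_div_of_nonneg_left Real.pi_pos.le (by norm_num) (by linarith)⟩

theorem criticalField_pos {n : ℕ} (hn : 2 ≤ n) {J : ℝ} (hJ : 0 < J) : 0 < criticalField n J := by
  obtain ⟨h1, h2⟩ := criticalAngle_bounds hn
  have := Real.tan_pos_of_pos_of_lt_pi_div_two h1 (by linarith [Real.pi_pos])
  rw [criticalField]; positivity

theorem sectorEnergy_sub_half {n m : ℕ} (hm : n = 2 * m) (hn : 2 ≤ n) (J h : ℝ) (N : ℕ) :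
    sectorEnergy n J h N - sectorEnergy n J h m = 2 * h * ((N : ℝ) - m)
      + 4 * J * Real.sin (((N : ℝ) - m) * (Real.pi / (2 * n))) ^ 2
        / (Real.sin (Real.pi / (2 * n)) * Real.cos (Real.pi / (2 * n))) := by
  have hn0 : (n : ℝ) ≠ 0 := by positivity
  have hnm : (n : ℝ) = 2 * m := by exact_mod_cast hm
  have hs : Real.sin (Real.pi / n)
      = 2 * (Real.sin (Real.pi / (2 * n)) * Real.cos (Real.pi / (2 * n))) := by
    rw [← mul_assoc, ← Real.sin_two_mul]; congr 1; field_simp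
  have hN : Real.sin (Real.pi * N / n)
      = 1 - 2 * Real.sin (((N : ℝ) - m) * (Real.pi / (2 * n))) ^ 2 := by
    have h1 : Real.pi * N / n
        = 2 * (((N : ℝ) - m) * (Real.pi / (2 * n))) + Real.pi / 2 := by
      field_simp
      rw [hnm]; ring
    rw [h1, Real.sin_add_pi_div_two, Real.cos_two_mul, Real.cos_sq']
    ring
  have hmm : Real.sin (Real.pi * m / n) = 1 := by
    rw [← Real.sin_pi_div_two]; congr 1
    field_simp
    rw [hnm, mul_comm]
  have hsp := (sin_pi_div_pos hn).ne'
  rw [hs] at hsp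
  have hsc := right_ne_zero_of_mul hsp
  rw [sectorEnergy, sectorEnergy, hopEnergy, hopEnergy, hs, hN, hmm]
  field_simp
  ring

/-- The energy cost of leaving `N = m = n / 2` at zero field is at least `2 h_crit` per flipped
spin, with equality exactly up to one flipped spin. -/
theorem sectorEnergy_sub_half_bound {n m : ℕ} (hm : n = 2 * m) (hn : 2 ≤ n) {J : ℝ} (hJ : 0 < J)
    (h : ℝ) {N k : ℕ} (hN : N ≤ n) (hk : |(N : ℝ) - m| = k) :
    2 * h * ((N : ℝ) - m) + 2 * criticalField n J * k
        ≤ sectorEnergy n J h N - sectorEnergy n J h m ∧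
      (k = 1 → sectorEnergy n J h N - sectorEnergy n J h m
        = 2 * h * ((N : ℝ) - m) + 2 * criticalField n J * k) ∧
      (2 ≤ k → 2 * h * ((N : ℝ) - m) + 2 * criticalField n J * k
        < sectorEnergy n J h N - sectorEnergy n J h m) := by
  obtain ⟨ha, ha4⟩ := criticalAngle_bounds hn
  have hnm : (n : ℝ) = 2 * m := by exact_mod_cast hm
  have hn0 : (n : ℝ) ≠ 0 := by positivity
  rw [sectorEnergy_sub_half hm hn, criticalField, Real.tan_eq_sin_div_cos]
  set a := Real.pi / (2 * n)
  have hs : 0 < Real.sin a := Real.sin_pos_of_pos_of_lt_pi ha (by linarith [Real.pi_pos])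
  have hc : 0 < Real.cos a := Real.cos_pos_of_mem_Ioo ⟨by linarith, by linarith [Real.pi_pos]⟩
  have hsq : Real.sin (((N : ℝ) - m) * a) ^ 2 = Real.sin (k * a) ^ 2 := by
    rw [← hk]
    rcases abs_choice ((N : ℝ) - m) with h | h <;> rw [h]
    rw [neg_mul, Real.sin_neg, neg_sq]
  have hkm : (k : ℝ) ≤ m := by
    have h1 : (N : ℝ) ≤ n := by exact_mod_cast hN
    have h2 : (0 : ℝ) ≤ N := Nat.cast_nonneg _
    rw [← hk, abs_le]
    constructor <;> linarith
  have hka : k * a ≤ Real.pi / 4 := by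
    have : (m : ℝ) * a = Real.pi / 4 := by
      have hm0 : (m : ℝ) ≠ 0 := by rintro h0; apply hn0; rw [hnm, h0, mul_zero]
      simp only [a]; rw [hnm]; field_simp; norm_num
    rw [← this]
    exact mul_le_mul_of_nonneg_right hkm ha.le
  obtain ⟨h1, h2⟩ := nat_mul_sin_sq_le ha hka
  rw [hsq, show 2 * (2 * J * (Real.sin a / Real.cos a)) * (k : ℝ)
    = 4 * J * (k * Real.sin a ^ 2) / (Real.sin a * Real.cos a) by field_simp; ring]
  have hsc : 0 < Real.sin a * Real.cos a := mul_pos hs hc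
  refine ⟨?_, ?_, fun hk2 => ?_⟩
  · gcongr
  · rintro rfl
    simp
  · have := h2 hk2
    gcongr

theorem exists_nat_abs_sub (N m : ℕ) : ∃ k : ℕ, |(N : ℝ) - m| = k := by
  refine ⟨((N : ℤ) - m).natAbs, ?_⟩
  rw [Nat.cast_natAbs]
  push_cast
  rfl

theorem isMinSector_of_abs_lt {n m : ℕ} (hm : n = 2 * m) (hn : 2 ≤ n) {J h : ℝ} (hJ : 0 < J)
    (hh : |h| < criticalField n J) (N : ℕ) : IsMinSector n J h N ↔ N = m := by
  have key (N : ℕ) (hN : N ≤ n) (hne : N ≠ m) : sectorEnergy n J h m < sectorEnergy n J h N := by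
    obtain ⟨k, hk⟩ := exists_nat_abs_sub N m
    have h1 := (sectorEnergy_sub_half_bound hm hn hJ h hN hk).1
    have hpos : 0 < |(N : ℝ) - m| := abs_pos.mpr (sub_ne_zero.mpr (by exact_mod_cast hne))
    have h2 := neg_abs_le (h * ((N : ℝ) - m))
    rw [abs_mul] at h2
    rw [← hk] at h1
    nlinarith
  constructor
  · rintro ⟨hN, hmin⟩
    by_contra hne
    exact absurd (hmin m (by omega)) (not_le.mpr (key N hN hne))
  · rintro rfl
    refine ⟨by omega, fun M hM => ?_⟩
    rcases eq_or_ne M N with rfl | hne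
    · exact le_rfl
    · exact (key M hM hne).le

/-- At the critical field the neighbour of `n / 2` favoured by the field joins it. -/
theorem isMinSector_of_abs_eq {n m : ℕ} (hm : n = 2 * m) (hn : 2 ≤ n) {J h : ℝ} (hJ : 0 < J)
    (hh : |h| = criticalField n J) :
    ∃ N₁ ≤ n, |2 * (N₁ : ℝ) - n| = 2 ∧ ∀ N, IsMinSector n J h N ↔ N = m ∨ N = N₁ := by
  have hnm : (n : ℝ) = 2 * m := by exact_mod_cast hm
  have hc := criticalField_pos hn hJ
  have hle (N : ℕ) (hN : N ≤ n) : sectorEnergy n J h m ≤ sectorEnergy n J h N := by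
    obtain ⟨k, hk⟩ := exists_nat_abs_sub N m
    have h1 := (sectorEnergy_sub_half_bound hm hn hJ h hN hk).1
    have h2 := neg_abs_le (h * ((N : ℝ) - m))
    rw [abs_mul, hh] at h2
    rw [← hk] at h1
    nlinarith
  have hiff (N : ℕ) : IsMinSector n J h N ↔ N ≤ n ∧ sectorEnergy n J h N = sectorEnergy n J h m :=
    ⟨fun hN => ⟨hN.1, le_antisymm (hN.2 m (by omega)) (hle N hN.1)⟩,
      fun hN => ⟨hN.1, fun M hM => hN.2.symm ▸ hle M hM⟩⟩
  obtain ⟨N₁, hN₁, hh1, habs⟩ : ∃ N₁ : ℕ, N₁ ≤ n ∧ h * ((N₁ : ℝ) - m) = -criticalField n J ∧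
      |(N₁ : ℝ) - m| = (1 : ℕ) := by
    rcases abs_eq hc.le |>.mp hh with h' | h'
    · refine ⟨m - 1, by omega, ?_, ?_⟩ <;> rw [Nat.cast_sub (by omega)]
      · rw [h']; push_cast; ring
      · norm_num
    · refine ⟨m + 1, by omega, ?_, ?_⟩
      · rw [h']; push_cast; ring
      · push_cast; norm_num
  refine ⟨N₁, hN₁, ?_, fun N => ?_⟩
  · rw [hnm, ← mul_sub, abs_mul, habs]; norm_num
  rw [hiff]
  constructor
  · rintro ⟨hN, he⟩
    obtain ⟨k, hk⟩ := exists_nat_abs_sub N m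
    obtain ⟨h1, -, h3⟩ := sectorEnergy_sub_half_bound hm hn hJ h hN hk
    rw [he, sub_self] at h1 h3
    by_cases hk2 : 2 ≤ k
    · have h2 := neg_abs_le (h * ((N : ℝ) - m))
      rw [abs_mul, hh, hk] at h2
      linarith [h3 hk2]
    · rcases Nat.eq_zero_or_pos k with rfl | hkpos
      · left
        rw [Nat.cast_zero, abs_eq_zero, sub_eq_zero] at hk
        exact_mod_cast hk
      · obtain rfl : k = 1 := by omega
        right
        -- Both `N` and `N₁` are neighbours of `m`, on the side that the field favours.
        have h4 : h * ((N : ℝ) - m) ≤ -criticalField n J := by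
          push_cast at h1; linarith
        rcases abs_eq_abs.mp (hk.trans habs.symm) with h5 | h5
        · have : (N : ℝ) = N₁ := by linarith
          exact_mod_cast this
        · rw [h5, mul_neg, hh1] at h4
          linarith
  · rintro (rfl | rfl)
    · exact ⟨by omega, rfl⟩
    · refine ⟨hN₁, ?_⟩
      have := (sectorEnergy_sub_half_bound hm hn hJ h hN₁ habs).2.1 rfl
      push_cast at this
      linarith

/-- Above the critical field all lowest sectors lie strictly on one side of `n / 2`. -/
theorem isMinSector_of_lt_abs {n m : ℕ} (hm : n = 2 * m) (hn : 2 ≤ n) {J h : ℝ} (hJ : 0 < J)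
    (hh : criticalField n J < |h|) :
    (∀ N, IsMinSector n J h N → N < m) ∨ (∀ N, IsMinSector n J h N → m < N) := by
  have hc := criticalField_pos hn hJ
  rcases lt_abs.mp hh with h' | h'
  · left
    intro N hN
    by_contra! hle
    have hmN : (m : ℝ) ≤ N := by exact_mod_cast hle
    obtain ⟨k, hk⟩ := exists_nat_abs_sub N m
    have h1 := (sectorEnergy_sub_half_bound hm hn hJ h hN.1 hk).1
    have hcast : ((m - 1 : ℕ) : ℝ) - m = -1 := by rw [Nat.cast_sub (by omega)]; simp
    have h2 := (sectorEnergy_sub_half_bound hm hn hJ h (N := m - 1) (k := 1) (by omega)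
      (by rw [hcast]; norm_num)).2.1 rfl
    have h3 := hN.2 (m - 1) (by omega)
    rw [hcast] at h2
    have hk0 : (0 : ℝ) ≤ k := Nat.cast_nonneg _
    push_cast at h2
    nlinarith
  · right
    intro N hN
    by_contra! hle
    have hmN : (N : ℝ) ≤ m := by exact_mod_cast hle
    obtain ⟨k, hk⟩ := exists_nat_abs_sub N m
    have h1 := (sectorEnergy_sub_half_bound hm hn hJ h hN.1 hk).1
    have hcast : ((m + 1 : ℕ) : ℝ) - m = 1 := by push_cast; ring
    have h2 := (sectorEnergy_sub_half_bound hm hn hJ h (N := m + 1) (k := 1) (by omega)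
      (by rw [hcast]; norm_num)).2.1 rfl
    have h3 := hN.2 (m + 1) (by omega)
    rw [hcast] at h2
    have hk0 : (0 : ℝ) ≤ k := Nat.cast_nonneg _
    push_cast at h2
    nlinarith

theorem sectorEnergy_half {n m : ℕ} (hm : n = 2 * m) (hn : 2 ≤ n) (J : ℝ) :
    sectorEnergy n J 0 m = -4 * J * (1 / Real.sin (Real.pi / n)) := by
  have hnm : (n : ℝ) = 2 * m := by exact_mod_cast hm
  have hn0 : (n : ℝ) ≠ 0 := by positivity
  have hmm : Real.sin (Real.pi * m / n) = 1 := by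
    rw [← Real.sin_pi_div_two]; congr 1
    field_simp
    rw [hnm, mul_comm]
  rw [sectorEnergy, hopEnergy, hmm]
  ring

/-! ### Time reversal, spin projection and concurrence -/

/-- The configuration with all spins reversed. -/
def spinFlip {n : ℕ} (s : Config n) : Config n := fun l => 1 - s l

@[simp] theorem spinFlip_spinFlip {n : ℕ} (s : Config n) : spinFlip (spinFlip s) = s := by
  ext l; simp [spinFlip]

theorem fin_two_one_sub_eq_zero_iff (b : Fin 2) : 1 - b = 0 ↔ ¬ b = 0 := by
  revert b; decide

theorem upCount_spinFlip {n : ℕ} (s : Config n) : upCount (spinFlip s) + upCount s = n := by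
  have h : upSet (spinFlip s) = (upSet s)ᶜ := by
    ext l; simp [spinFlip, fin_two_one_sub_eq_zero_iff]
  rw [upCount, upCount, h, Finset.card_compl_add_card, Fintype.card_fin]

theorem timeReversal_apply {n : ℕ} (ψ : QVec n) (s : Config n) :
    timeReversal ψ s = (-1) ^ upCount s * star (ψ (spinFlip s)) := by
  have hent (a b : Fin 2) : ((-Complex.I) • pauliY) a b
      = if b = 1 - a then (if a = 0 then -1 else 1) else 0 := by
    fin_cases a <;> fin_cases b <;> simp [pauliY]
  rw [timeReversal, Matrix.mulVec, dotProduct, Finset.sum_eq_single (spinFlip s)]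
  · rw [tensorOp, Matrix.of_apply, Pi.star_apply]
    congr 1
    simp_rw [hent]
    simp [spinFlip, Finset.prod_ite, upCount, upSet]
  · intro t _ ht
    obtain ⟨l, hl⟩ := Function.ne_iff.mp ht
    rw [tensorOp, Matrix.of_apply,
      Finset.prod_eq_zero (Finset.mem_univ l) ((hent _ _).trans (if_neg hl)), zero_mul]
  · simp

theorem nConcurrence_eq_zero {n : ℕ} {ψ : QVec n} (h : ∀ s, ψ s = 0 ∨ ψ (spinFlip s) = 0) :
    nConcurrence ψ = 0 := by
  rw [nConcurrence, norm_eq_zero, dotProduct]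
  refine Finset.sum_eq_zero fun s _ => ?_
  rw [timeReversal_apply, Pi.star_apply]
  rcases h s with h | h <;> simp [h]

theorem hop_comp_spinFlip {n : ℕ} [NeZero n] (ψ : QVec n) (s : Config n) :
    hop (fun t => ψ (spinFlip t)) s = hop ψ (spinFlip s) := by
  rw [hop, hop]
  refine Finset.sum_congr rfl fun l _ => ?_
  have : (spinFlip s l ≠ spinFlip s (l + 1)) ↔ s l ≠ s (l + 1) := by simp [spinFlip]
  simp only [this]
  rfl

/-- The zero-field Hamiltonian commutes with the spin flip, so its unique ground state is an
eigenvector of the flip. -/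
theorem exists_refVec_spinFlip {n m : ℕ} [NeZero n] (hm : n = 2 * m) (hn2 : 2 ≤ n) :
    ∃ κ : ℂ, ‖κ‖ = 1 ∧
      ∀ s : Config n, upCount s = m → (refVec (spinFlip s) : ℂ) = κ * refVec s := by
  have hn : Even n := ⟨m, by omega⟩
  have hmin := isMinSector_of_abs_lt hm hn2 (h := 0) one_pos
    (by rw [abs_zero]; exact criticalField_pos hn2 one_pos)
  have hflip (s : Config n) : upCount (spinFlip s) = m ↔ upCount s = m := by
    have := upCount_spinFlip s; omega
  have h0 : sectorVec n (Pi.single m 1) ∈ groundSpace (hamXX n 1 0) := by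
    refine (mem_groundSpace_hamXX hn2 hn one_pos).mpr ⟨_, fun N _ hN => (hmin N).mpr ?_, rfl⟩
    by_contra hne
    simp [hne] at hN
  have h1 : (fun s => sectorVec n (Pi.single m 1) (spinFlip s)) ∈ groundSpace (hamXX n 1 0) := by
    rw [groundSpace, Module.End.mem_eigenspace_iff, Matrix.toLin'_apply] at h0 ⊢
    funext s
    have := congrFun h0 (spinFlip s)
    rw [hamXX_mulVec hn2, Pi.smul_apply] at this ⊢
    rw [hop_comp_spinFlip]
    simpa using this
  obtain ⟨c, -, hc⟩ := (mem_groundSpace_hamXX hn2 hn one_pos).mp h1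
  have hκ (s : Config n) (hs : upCount s = m) :
      (refVec (spinFlip s) : ℂ) = c m * refVec s := by
    have := congrFun hc s
    simp only [sectorVec, (hflip s).mpr hs, hs, Pi.single_eq_same, mul_one] at this
    rw [this, mul_comm]
  refine ⟨c m, ?_, hκ⟩
  obtain ⟨s, hs⟩ := exists_upCount_eq (n := n) (N := m) (by omega)
  have h2 := hκ (spinFlip s) ((hflip s).mpr hs)
  rw [spinFlip_spinFlip, hκ s hs, ← mul_assoc] at h2
  have href : (refVec s : ℂ) ≠ 0 := by exact_mod_cast refVec_ne_zero s
  have h3 : c m * c m = 1 := by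
    apply mul_right_cancel₀ href
    rw [← h2, one_mul]
  have h4 := congrArg norm h3
  rw [norm_mul, norm_one] at h4
  nlinarith [norm_nonneg (c m)]

/-- A vector fixed by time reversal up to a phase has maximal concurrence. -/
theorem nConcurrence_eq_one {n : ℕ} {ψ : QVec n} (hψ : star ψ ⬝ᵥ ψ = 1) {ω : ℂ} (hω : ‖ω‖ = 1)
    (h : timeReversal ψ = ω • ψ) : nConcurrence ψ = 1 := by
  rw [nConcurrence, h, dotProduct_smul, hψ, smul_eq_mul, mul_one, hω]

theorem nConcurrence_sectorVec_half {n m : ℕ} [NeZero n] (hm : n = 2 * m) (hn2 : 2 ≤ n)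
    {c : ℕ → ℂ} (hc : ∀ N ≤ n, c N ≠ 0 → N = m)
    (hψ : star (sectorVec n c) ⬝ᵥ sectorVec n c = 1) : nConcurrence (sectorVec n c) = 1 := by
  obtain ⟨κ, hκ, hflip⟩ := exists_refVec_spinFlip hm hn2
  have hvan (s : Config n) (hs : upCount s ≠ m) : sectorVec n c s = 0 := by
    rw [sectorVec]
    by_contra h0
    exact hs (hc _ (upCount_le s) (right_ne_zero_of_mul h0))
  have hcm : c m ≠ 0 := by
    intro h0
    have : sectorVec n c = 0 := by
      funext s
      by_cases hs : upCount s = m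
      · simp [sectorVec, hs, h0]
      · exact hvan s hs
    rw [this] at hψ
    simp at hψ
  refine nConcurrence_eq_one hψ (ω := (-1) ^ m * star κ * (star (c m) / c m)) ?_ ?_
  · rw [norm_mul, norm_mul, norm_div, norm_star, norm_star, hκ, div_self (norm_ne_zero_iff.mpr hcm)]
    simp
  · funext s
    have hup := upCount_spinFlip s
    rw [timeReversal_apply, Pi.smul_apply, smul_eq_mul]
    by_cases hs : upCount s = m
    · have hs' : upCount (spinFlip s) = m := by omega
      simp only [sectorVec, hs, hs', hflip s hs, star_mul', Complex.star_def, Complex.conj_ofReal]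
      field_simp
    · rw [hvan s hs, hvan (spinFlip s) (by omega)]
      simp

theorem hasSz_sectorVec {n N : ℕ} {c : ℕ → ℂ} (hc : ∀ M ≤ n, c M ≠ 0 → M = N) :
    HasSz (sectorVec n c) (2 * N - n) := by
  rw [HasSz]
  funext s
  rw [totalSz_mulVec, Pi.smul_apply, smul_eq_mul]
  by_cases h : c (upCount s) = 0
  · simp [sectorVec, h]
  · rw [hc _ (upCount_le s) h]
    push_cast; rfl

theorem ne_zero_of_unit {n : ℕ} {ψ : QVec n} (hψ : star ψ ⬝ᵥ ψ = 1) : ψ ≠ 0 := by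
  rintro rfl
  simp at hψ

theorem HasSz.exists_upCount {n : ℕ} {ψ : QVec n} {s : ℝ} (h : HasSz ψ s) (hψ : ψ ≠ 0) :
    ∃ t : Config n, ψ t ≠ 0 ∧ s = 2 * upCount t - n := by
  obtain ⟨t, ht⟩ := Function.ne_iff.mp hψ
  refine ⟨t, ht, ?_⟩
  have := congrFun h t
  rw [totalSz_mulVec, Pi.smul_apply, smul_eq_mul] at this
  have := mul_right_cancel₀ ht this
  exact_mod_cast this.symm

theorem HasSz.unique {n : ℕ} {ψ : QVec n} {s s' : ℝ} (h : HasSz ψ s) (h' : HasSz ψ s')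
    (hψ : ψ ≠ 0) : s = s' := by
  rw [HasSz, h'] at h
  exact_mod_cast (smul_left_injective ℂ hψ h).symm

/-- The ground state of the sector with `N` up spins can be normalized. -/
theorem exists_unit_sectorVec {n N : ℕ} (hN : N ≤ n) :
    ∃ a : ℂ, a ≠ 0 ∧
      star (sectorVec n (Pi.single N a)) ⬝ᵥ sectorVec n (Pi.single N a) = 1 := by
  set v := sectorVec n (Pi.single N 1)
  set S : ℝ := ∑ s, Complex.normSq (v s)
  have hS : 0 < S := by
    obtain ⟨s, hs⟩ := Function.ne_iff.mp (sectorVec_single_ne_zero hN)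
    exact Finset.sum_pos' (fun s _ => Complex.normSq_nonneg _)
      ⟨s, Finset.mem_univ s, Complex.normSq_pos.mpr hs⟩
  have hv (a : ℂ) : sectorVec n (Pi.single N a) = a • v := by
    funext s
    by_cases hs : upCount s = N
    · simp [v, sectorVec, hs, mul_comm]
    · simp [v, sectorVec, hs]
  have hvv : star v ⬝ᵥ v = (S : ℂ) := by
    rw [dotProduct]
    simp only [S]
    push_cast
    exact Finset.sum_congr rfl fun s _ => (Complex.normSq_eq_conj_mul_self).symm
  refine ⟨((√S)⁻¹ : ℝ), by exact_mod_cast (inv_pos.mpr (Real.sqrt_pos.mpr hS)).ne', ?_⟩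
  rw [hv, star_smul, smul_dotProduct, dotProduct_smul, hvv, Complex.star_def, Complex.conj_ofReal,
    smul_eq_mul, smul_eq_mul]
  norm_cast
  rw [← mul_assoc, ← mul_inv, Real.mul_self_sqrt hS.le, inv_mul_cancel₀ hS.ne']

theorem sectorVec_single_mem_groundSpace {n N : ℕ} [NeZero n] (hn2 : 2 ≤ n) (hn : Even n)
    {J h : ℝ} (hJ : 0 < J) (hN : IsMinSector n J h N) (a : ℂ) :
    sectorVec n (Pi.single N a) ∈ groundSpace (hamXX n J h) := by
  refine (mem_groundSpace_hamXX hn2 hn hJ).mpr ⟨_, fun M _ hM => ?_, rfl⟩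
  obtain rfl : M = N := by
    by_contra hne
    simp [hne] at hM
  exact hN

theorem two_le_finrank_of_hasSz {n : ℕ} {V : Submodule ℂ (QVec n)} {ψ φ : QVec n} {s s' : ℝ}
    (hψ : ψ ∈ V) (hφ : φ ∈ V) (hψ0 : ψ ≠ 0) (hφ0 : φ ≠ 0) (hs : HasSz ψ s) (hs' : HasSz φ s')
    (hne : s ≠ s') : 2 ≤ Module.finrank ℂ V := by
  have hlin : LinearIndependent ℂ ![ψ, φ] := by
    rw [LinearIndependent.pair_iff]
    intro a b hab
    have h1 := congrArg (totalSz n *ᵥ ·) hab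
    simp only [Matrix.mulVec_add, Matrix.mulVec_smul, Matrix.mulVec_zero] at h1
    rw [hs, hs'] at h1
    have h2 : (b * (s' - s) : ℂ) • φ = 0 := by
      have : (b * (s' - s) : ℂ) • φ
          = (a • (s : ℂ) • ψ + b • (s' : ℂ) • φ) - (s : ℂ) • (a • ψ + b • φ) := by module
      rw [this, h1, hab, smul_zero, sub_zero]
    have h3 : ((s' : ℂ) - s) ≠ 0 := sub_ne_zero.mpr (by exact_mod_cast hne.symm)
    have hb : b = 0 := by
      rcases smul_eq_zero.mp h2 with h | h
      · exact (mul_eq_zero.mp h).resolve_right h3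
      · exact absurd h hφ0
    rw [hb, zero_smul, add_zero] at hab
    exact ⟨(smul_eq_zero.mp hab).resolve_right hψ0, hb⟩
  have h4 := finrank_span_eq_card hlin
  rw [Fintype.card_fin] at h4
  refine h4.symm.le.trans (Submodule.finrank_mono (Submodule.span_le.mpr ?_))
  rintro _ ⟨i, rfl⟩
  fin_cases i
  · exact hψ
  · exact hφ

/-! ### The three regimes of the field -/

theorem finrank_groundSpace_of_abs_lt {n m : ℕ} [NeZero n] (hm : n = 2 * m) (hn2 : 2 ≤ n)
    {J h : ℝ} (hJ : 0 < J) (hh : |h| < criticalField n J) :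
    Module.finrank ℂ (groundSpace (hamXX n J h)) = 1 := by
  have hn : Even n := ⟨m, by omega⟩
  have hmin := isMinSector_of_abs_lt hm hn2 hJ hh
  have hspan : groundSpace (hamXX n J h) = Submodule.span ℂ {sectorVec n (Pi.single m 1)} := by
    apply le_antisymm
    · intro ψ hψ
      obtain ⟨c, hc, rfl⟩ := (mem_groundSpace_hamXX hn2 hn hJ).mp hψ
      refine Submodule.mem_span_singleton.mpr ⟨c m, ?_⟩
      funext s
      rw [Pi.smul_apply, smul_eq_mul, sectorVec, sectorVec]
      by_cases hs : upCount s = m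
      · simp [hs, mul_comm]
      · have : c (upCount s) = 0 := by
          by_contra h0
          exact hs ((hmin _).mp (hc _ (upCount_le s) h0))
        simp [hs, this]
    · rw [Submodule.span_singleton_le_iff_mem]
      exact sectorVec_single_mem_groundSpace hn2 hn hJ ((hmin m).mpr rfl) 1
  rw [hspan, finrank_span_singleton (sectorVec_single_ne_zero (by omega))]

theorem IsGroundState.of_abs_lt {n m : ℕ} [NeZero n] (hm : n = 2 * m) (hn2 : 2 ≤ n)
    {J h : ℝ} (hJ : 0 < J) (hh : |h| < criticalField n J) {ψ : QVec n}
    (hψ : IsGroundState (hamXX n J h) ψ) : HasSz ψ 0 ∧ nConcurrence ψ = 1 := by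
  have hn : Even n := ⟨m, by omega⟩
  obtain ⟨c, hc, rfl⟩ := (mem_groundSpace_hamXX hn2 hn hJ).mp hψ.1
  have hc' (N : ℕ) (hN : N ≤ n) (h0 : c N ≠ 0) : N = m :=
    (isMinSector_of_abs_lt hm hn2 hJ hh N).mp (hc N hN h0)
  refine ⟨?_, nConcurrence_sectorVec_half hm hn2 hc' hψ.2⟩
  have := hasSz_sectorVec hc'
  rwa [show (2 * m - n : ℝ) = 0 by rw [sub_eq_zero]; exact_mod_cast hm.symm] at this

theorem exists_span_pair_of_abs_eq {n m : ℕ} [NeZero n] (hm : n = 2 * m) (hn2 : 2 ≤ n)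
    {J h : ℝ} (hJ : 0 < J) (hh : |h| = criticalField n J) :
    ∃ ψ φ : QVec n, ∃ s : ℝ, |s| = 2 ∧ IsGroundState (hamXX n J h) ψ ∧ HasSz ψ 0 ∧
      IsGroundState (hamXX n J h) φ ∧ HasSz φ s ∧ nConcurrence φ = 0 ∧
      groundSpace (hamXX n J h) = Submodule.span ℂ {ψ, φ} := by
  have hn : Even n := ⟨m, by omega⟩
  have hnm : (n : ℝ) = 2 * m := by exact_mod_cast hm
  obtain ⟨N₁, hN₁, hs, hmin⟩ := isMinSector_of_abs_eq hm hn2 hJ hh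
  have hne : N₁ ≠ m := by
    rintro rfl
    rw [hnm, sub_self, abs_zero] at hs
    norm_num at hs
  have hsingle (N : ℕ) (a : ℂ) : ∀ M ≤ n, (Pi.single N a : ℕ → ℂ) M ≠ 0 → M = N := by
    intro M _ hM
    by_contra hMN
    simp [hMN] at hM
  obtain ⟨a, ha, ha1⟩ := exists_unit_sectorVec (n := n) (N := m) (by omega)
  obtain ⟨b, hb, hb1⟩ := exists_unit_sectorVec hN₁
  have hψ := sectorVec_single_mem_groundSpace hn2 hn hJ ((hmin m).mpr (Or.inl rfl)) a
  have hφ := sectorVec_single_mem_groundSpace hn2 hn hJ ((hmin N₁).mpr (Or.inr rfl)) b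
  refine ⟨_, _, _, hs, ⟨hψ, ha1⟩, ?_, ⟨hφ, hb1⟩, hasSz_sectorVec (hsingle N₁ b), ?_, ?_⟩
  · have := hasSz_sectorVec (hsingle m a)
    rwa [hnm, sub_self] at this
  · refine nConcurrence_eq_zero fun s => ?_
    by_contra! h0
    have h1 := hsingle N₁ b _ (upCount_le _) (right_ne_zero_of_mul h0.1)
    have h2 := hsingle N₁ b _ (upCount_le _) (right_ne_zero_of_mul h0.2)
    have h3 := upCount_spinFlip s
    omega
  · apply le_antisymm
    · intro χ hχ
      obtain ⟨c, hc, rfl⟩ := (mem_groundSpace_hamXX hn2 hn hJ).mp hχ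
      refine Submodule.mem_span_pair.mpr ⟨c m / a, c N₁ / b, ?_⟩
      funext s
      simp only [Pi.add_apply, Pi.smul_apply, smul_eq_mul, sectorVec]
      by_cases hs : upCount s = m
      · rw [hs, Pi.single_eq_same, Pi.single_eq_of_ne hne.symm]
        field_simp
        ring
      · by_cases hs1 : upCount s = N₁
        · rw [hs1, Pi.single_eq_same, Pi.single_eq_of_ne hne]
          field_simp
          ring
        · have : c (upCount s) = 0 := by
            by_contra h0
            exact ((hmin _).mp (hc _ (upCount_le s) h0)).elim hs hs1
          simp [hs, hs1, this]
    · rw [Submodule.span_le]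
      rintro _ (rfl | rfl)
      · exact hψ
      · exact hφ

theorem IsGroundState.of_lt_abs {n m : ℕ} [NeZero n] (hm : n = 2 * m) (hn2 : 2 ≤ n)
    {J h : ℝ} (hJ : 0 < J) (hh : criticalField n J < |h|) {ψ : QVec n}
    (hψ : IsGroundState (hamXX n J h) ψ) :
    nConcurrence ψ = 0 ∧ ∀ s : ℝ, HasSz ψ s → 2 ≤ |s| := by
  have hn : Even n := ⟨m, by omega⟩
  have hnm : (n : ℝ) = 2 * m := by exact_mod_cast hm
  have hψ0 := ne_zero_of_unit hψ.2
  obtain ⟨c, hc, rfl⟩ := (mem_groundSpace_hamXX hn2 hn hJ).mp hψ.1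
  have hsupp (s : Config n) (h0 : sectorVec n c s ≠ 0) : IsMinSector n J h (upCount s) :=
    hc _ (upCount_le s) (right_ne_zero_of_mul h0)
  have hside := isMinSector_of_lt_abs hm hn2 hJ hh
  constructor
  · refine nConcurrence_eq_zero fun s => ?_
    by_contra! h0
    have h3 := upCount_spinFlip s
    rcases hside with hside | hside <;>
    · have h1 := hside _ (hsupp _ h0.1)
      have h2 := hside _ (hsupp _ h0.2)
      omega
  · intro s hs
    obtain ⟨t, ht, rfl⟩ := hs.exists_upCount hψ0
    rw [hnm, le_abs]
    rcases hside with hside | hside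
    · right
      have : (upCount t : ℝ) + 1 ≤ m := by exact_mod_cast hside _ (hsupp t ht)
      linarith
    · left
      have : (m : ℝ) + 1 ≤ upCount t := by exact_mod_cast hside _ (hsupp t ht)
      linarith

theorem exists_isGroundState_hasSz {n : ℕ} [NeZero n] (hn2 : 2 ≤ n) (hn : Even n) (J h : ℝ)
    (hJ : 0 < J) : ∃ ψ : QVec n, ∃ s : ℝ, IsGroundState (hamXX n J h) ψ ∧ HasSz ψ s := by
  obtain ⟨N, hN⟩ := exists_isMinSector n J h
  obtain ⟨a, -, ha⟩ := exists_unit_sectorVec hN.1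
  refine ⟨_, _, ⟨sectorVec_single_mem_groundSpace hn2 hn hJ hN a, ha⟩,
    hasSz_sectorVec (N := N) fun M _ hM => ?_⟩
  by_contra hMN
  simp [hMN] at hM

end XXChain

end

theorem mainTheorem2 (n : ℕ) [NeZero n] (hn : Even n) (J : ℝ) (hJ : 0 < J) :
    -- the zero-field ground energy is `-4 J csc (π / n)`
    IsLeast (XXChain.energyLevels (XXChain.hamXX n J 0)) (-4 * J * (1 / Real.sin (Real.pi / n))) ∧
    -- below the critical field: a nondegenerate ground state, with `s_z = 0` and concurrence `1`
    (∀ h : ℝ, |h| < XXChain.criticalField n J →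
      Module.finrank ℂ (XXChain.groundSpace (XXChain.hamXX n J h)) = 1 ∧
      ∀ ψ : XXChain.QVec n, XXChain.IsGroundState (XXChain.hamXX n J h) ψ →
        XXChain.HasSz ψ 0 ∧ XXChain.nConcurrence ψ = 1) ∧
    -- at the critical field: a doubly degenerate ground level, spanned by a state with `s_z = 0`
    -- and one with `|s_z| = 2`, the latter having concurrence `0`
    (∀ h : ℝ, |h| = XXChain.criticalField n J →
      ∃ ψ φ : XXChain.QVec n, ∃ s : ℝ, |s| = 2 ∧
        XXChain.IsGroundState (XXChain.hamXX n J h) ψ ∧ XXChain.HasSz ψ 0 ∧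
        XXChain.IsGroundState (XXChain.hamXX n J h) φ ∧ XXChain.HasSz φ s ∧
        XXChain.nConcurrence φ = 0 ∧
        XXChain.groundSpace (XXChain.hamXX n J h) = Submodule.span ℂ {ψ, φ}) ∧
    -- above the critical field: every ground state has concurrence `0`; there are ground states
    -- with a definite `s_z`, and all of them have `|s_z| ≥ 2`
    (∀ h : ℝ, XXChain.criticalField n J < |h| →
      (∀ ψ : XXChain.QVec n, XXChain.IsGroundState (XXChain.hamXX n J h) ψ →
        XXChain.nConcurrence ψ = 0 ∧ ∀ s : ℝ, XXChain.HasSz ψ s → 2 ≤ |s|) ∧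
      ∃ ψ : XXChain.QVec n, ∃ s : ℝ,
        XXChain.IsGroundState (XXChain.hamXX n J h) ψ ∧ XXChain.HasSz ψ s) ∧
    -- the critical field is the least field strength at which a ground state with `s_z = 0` is
    -- degenerate with one with `|s_z| = 2`
    IsLeast {t : ℝ | ∃ h : ℝ, |h| = t ∧ ∃ ψ φ : XXChain.QVec n, ∃ s : ℝ, |s| = 2 ∧
      XXChain.IsGroundState (XXChain.hamXX n J h) ψ ∧ XXChain.HasSz ψ 0 ∧
      XXChain.IsGroundState (XXChain.hamXX n J h) φ ∧ XXChain.HasSz φ s}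
      (XXChain.criticalField n J) ∧
    -- and the least field strength at which the ground level is degenerate at all
    IsLeast {t : ℝ | ∃ h : ℝ, |h| = t ∧
      2 ≤ Module.finrank ℂ (XXChain.groundSpace (XXChain.hamXX n J h))}
      (XXChain.criticalField n J) := by
  obtain ⟨m, hm'⟩ := hn
  have hm : n = 2 * m := by omega
  have hn2 : 2 ≤ n := by have := NeZero.ne n; omega
  have hn : Even n := ⟨m, hm'⟩
  have hc := XXChain.criticalField_pos hn2 hJ
  have habs : |XXChain.criticalField n J| = XXChain.criticalField n J := abs_of_pos hc
  obtain ⟨ψ, φ, s, hs, hψ, hψs, hφ, hφs, -, -⟩ := XXChain.exists_span_pair_of_abs_eq hm hn2 hJ habs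
  refine ⟨?_, fun h hh => ⟨XXChain.finrank_groundSpace_of_abs_lt hm hn2 hJ hh,
      fun ψ hψ => hψ.of_abs_lt hm hn2 hJ hh⟩,
    fun h hh => XXChain.exists_span_pair_of_abs_eq hm hn2 hJ hh,
    fun h hh => ⟨fun ψ hψ => hψ.of_lt_abs hm hn2 hJ hh,
      XXChain.exists_isGroundState_hasSz hn2 hn J h hJ⟩, ⟨?_, ?_⟩, ⟨?_, ?_⟩⟩
  · rw [← XXChain.sectorEnergy_half hm hn2]
    exact XXChain.isLeast_energyLevels hn2 hn hJ
      ((XXChain.isMinSector_of_abs_lt hm hn2 hJ (by rwa [abs_zero]) m).mpr rfl)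
  · exact ⟨_, habs, ψ, φ, s, hs, hψ, hψs, hφ, hφs⟩
  · rintro _ ⟨h, rfl, -, φ, s, hs, -, -, hφ, hφs⟩
    by_contra! hlt
    have h0 := hφs.unique (hφ.of_abs_lt hm hn2 hJ hlt).1 (XXChain.ne_zero_of_unit hφ.2)
    rw [h0, abs_zero] at hs
    norm_num at hs
  · refine ⟨_, habs, XXChain.two_le_finrank_of_hasSz hψ.1 hφ.1 (XXChain.ne_zero_of_unit hψ.2)
      (XXChain.ne_zero_of_unit hφ.2) hψs hφs ?_⟩
    rintro rfl
    rw [abs_zero] at hs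
    norm_num at hs
  · rintro _ ⟨h, rfl, hrank⟩
    by_contra! hlt
    rw [XXChain.finrank_groundSpace_of_abs_lt hm hn2 hJ hlt] at hrank
    omega
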